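/- For $x,y\in\mathbb{H}^l$ let $\langle x,y\rangle=\sum_{p=1}^l \bar x_p y_p\in\mathbb{H}$ and $\|x\|=\sqrt{\langle x,x\rangle}$; in particular $\langle\delta,\varepsilon\rangle=\bar\delta\varepsilon$ for $\delta,\varepsilon\in\mathbb{H}$. Put $$P(x)=\frac{3x}{2}\int_0^{\pi/2}\frac{\cos^4 t}{\sqrt{1-x^2\sin^2 t}}\,dt\quad(0\le x\le 1),\qquad \alpha_{GW}^{\mathbb{H}}=\inf_{0\le x\le 1}\frac{1+P(x)}{1+x}.$$ **Theorem (Cones of diagonally dominant matrices).** Let $A=(a_{ij})\in\mathbb{R}^{n\times n}$ be symmetric and diagonally dominant, i.e. $a_{ii}\ge\sum_{j\ne i}|a_{ij}|$ for all $i$. Then for every $l\ge 1$ $$\max_{\|x_i\|=1}\Bigl|\sum_{i,j=1}^n a_{ij}\langle x_i,x_j\rangle\Bigr|\le\Bigl(1+\frac{1-\frac{9\pi}{32}}{\alpha_{GW}^{\mathbb{H}}}\Bigr)\max_{|\delta_i|=1}\Bigl|\sum_{i,j=1}^n a_{ij}\langle\delta_i,\delta_j\rangle\Bigr|,$$ where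 $x_1,\dots,x_n\in\mathbb{H}^l$ and $\delta_1,\dots,\delta_n\in\mathbb{H}$. The constant on the right is $1.1204$ to four decimal places (it differs from $1.1204$ by less than $5\cdot 10^{-5}$). Moreover, all these maxima exist, the maximum on the left equals both $$\max_{\|x_i\|\le1}\Bigl|\sum_{i,j=1}^n a_{ij}\langle x_i,x_j\rangle\Bigr|\quad\text{and}\quad\max_{\|x_i\|=\|y_j\|=1}\Bigl|\sum_{i,j=1}^n a_{ij}\langle x_i,y_j\rangle\Bigr|\qquad(x_i,y_j\in\mathbb{H}^l),$$ and the maximum on the right equals both $$\max_{|\delta_i|\le1}\Bigl|\sum_{i,j=1}^n a_{ij}\langle \delta_i,\delta_j\rangle\Bigr|\quad\text{and}\quad\max_{|\delta_i|=|\varepsilon_j|=1}\Bigl|\sum_{i,j=1}^n a_{ij}\langle \delta_i,\varepsilon_j\rangle\Bigr|\qquad(\delta_i,\varepsilon_j\in\mathbb{H}),$$ so that either side of the inequality may be replaced by any of these expressions. -/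

import Mathlib

open scoped Quaternion

noncomputable section

namespace QuatGrothendieck

/-- The cone of real symmetric diagonally dominant matrices:
`A` is symmetric and `a_ii ≥ ∑_{j ≠ i} |a_ij|` for every `i`. -/
def IsSymmDiagDominant {n : ℕ} (A : Matrix (Fin n) (Fin n) ℝ) : Prop :=
  A.IsSymm ∧ ∀ i, ∑ j ∈ Finset.univ.erase i, |A i j| ≤ A i i

/-- The `ℍ`-valued inner product `⟨x, y⟩ = ∑ₚ x̄ₚ yₚ` on the right vector space `ℍ^l`.
The norm on `EuclideanSpace ℍ[ℝ] (Fin l)` is the corresponding one, `‖x‖ = √(∑ₚ |xₚ|²)`. -/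
def qInner {l : ℕ} (x y : EuclideanSpace ℍ[ℝ] (Fin l)) : ℍ[ℝ] :=
  ∑ p, star (x p) * y p

/-- `|∑ᵢ ∑ⱼ a_ij ⟨xᵢ, yⱼ⟩|` for vectors `xᵢ, yⱼ ∈ ℍ^l`. -/
def vecForm {n l : ℕ} (A : Matrix (Fin n) (Fin n) ℝ)
    (x y : Fin n → EuclideanSpace ℍ[ℝ] (Fin l)) : ℝ :=
  ‖∑ i, ∑ j, A i j • qInner (x i) (y j)‖

/-- `|∑ᵢ ∑ⱼ a_ij δ̄ᵢ εⱼ|` for quaternions `δᵢ, εⱼ`. -/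
def scalForm {n : ℕ} (A : Matrix (Fin n) (Fin n) ℝ) (δ ε : Fin n → ℍ[ℝ]) : ℝ :=
  ‖∑ i, ∑ j, A i j • (star (δ i) * ε j)‖

/-- The values `|∑ a_ij ⟨xᵢ, xⱼ⟩|` with `‖xᵢ‖ = 1`. -/
def vecSphereValues {n : ℕ} (A : Matrix (Fin n) (Fin n) ℝ) (l : ℕ) : Set ℝ :=
  {r | ∃ x : Fin n → EuclideanSpace ℍ[ℝ] (Fin l), (∀ i, ‖x i‖ = 1) ∧ r = vecForm A x x}

/-- The values `|∑ a_ij ⟨xᵢ, xⱼ⟩|` with `‖xᵢ‖ ≤ 1`. -/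
def vecBallValues {n : ℕ} (A : Matrix (Fin n) (Fin n) ℝ) (l : ℕ) : Set ℝ :=
  {r | ∃ x : Fin n → EuclideanSpace ℍ[ℝ] (Fin l), (∀ i, ‖x i‖ ≤ 1) ∧ r = vecForm A x x}

/-- The values `|∑ a_ij ⟨xᵢ, yⱼ⟩|` with `‖xᵢ‖ = ‖yⱼ‖ = 1`. -/
def vecPairValues {n : ℕ} (A : Matrix (Fin n) (Fin n) ℝ) (l : ℕ) : Set ℝ :=
  {r | ∃ x y : Fin n → EuclideanSpace ℍ[ℝ] (Fin l),
    (∀ i, ‖x i‖ = 1) ∧ (∀ j, ‖y j‖ = 1) ∧ r = vecForm A x y}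

/-- The values `|∑ a_ij δ̄ᵢ δⱼ|` with `|δᵢ| = 1`. -/
def scalSphereValues {n : ℕ} (A : Matrix (Fin n) (Fin n) ℝ) : Set ℝ :=
  {r | ∃ δ : Fin n → ℍ[ℝ], (∀ i, ‖δ i‖ = 1) ∧ r = scalForm A δ δ}

/-- The values `|∑ a_ij δ̄ᵢ δⱼ|` with `|δᵢ| ≤ 1`. -/
def scalBallValues {n : ℕ} (A : Matrix (Fin n) (Fin n) ℝ) : Set ℝ :=
  {r | ∃ δ : Fin n → ℍ[ℝ], (∀ i, ‖δ i‖ ≤ 1) ∧ r = scalForm A δ δ}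

/-- The values `|∑ a_ij δ̄ᵢ εⱼ|` with `|δᵢ| = |εⱼ| = 1`. -/
def scalPairValues {n : ℕ} (A : Matrix (Fin n) (Fin n) ℝ) : Set ℝ :=
  {r | ∃ δ ε : Fin n → ℍ[ℝ],
    (∀ i, ‖δ i‖ = 1) ∧ (∀ j, ‖ε j‖ = 1) ∧ r = scalForm A δ ε}

/-- `P(x) = (3x/2) ∫₀^{π/2} cos⁴ t / √(1 - x² sin² t) dt` for real `x ∈ [-1, 1]`.
At `x = ±1` the integrand is `cos³ t` for `0 ≤ t < π/2`. -/
def haagerupP (x : ℝ) : ℝ :=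
  3 * x / 2 * ∫ t in (0 : ℝ)..(Real.pi / 2),
    Real.cos t ^ 4 / Real.sqrt (1 - x ^ 2 * Real.sin t ^ 2)

/-- The quaternion Goemans–Williamson constant `inf_{0 ≤ x ≤ 1} (1 + P(x)) / (1 + x)`. -/
def alphaGW : ℝ :=
  sInf ((fun x : ℝ => (1 + haagerupP x) / (1 + x)) '' Set.Icc 0 1)

/-- The constant `1 + (1 - 9π/32) / α_GW^ℍ`. -/
def ddConstant : ℝ :=
  1 + (1 - 9 * Real.pi / 32) / alphaGW

end QuatGrothendieck

end

/-!
For a symmetric diagonally dominant `A` the quantity `∑ a_ij ⟨xᵢ, xⱼ⟩` is the real number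
`∑ a_ij Re ⟨xᵢ, xⱼ⟩`, a positive semidefinite real quadratic form (`realForm`) in which `ℍ^l` only
plays the role of the Euclidean space `ℝ^(4l)`. Its maximum over unit vectors exists by compactness.
By convexity it is also the maximum over the balls, since every vector of the ball is a midpoint of
two unit vectors, and by Cauchy–Schwarz, after a common right rotation of the `yⱼ`, it is the maximum
over pairs (`IsSymmDiagDominant.exists_isGreatest`). The scalar maxima are the case `l = 1`.

The comparison of the two maxima is a randomised rounding. Unit vectors `xᵢ ∈ ℝ^m` are sent to
`δ(xᵢ) = φ(G xᵢ) ∈ ℝ⁴ = ℍ`, where `G` is a Gaussian `4 × m` matrix and `φ(u) = u / (‖u‖ + ε)` is an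
odd Lipschitz approximation of `u / ‖u‖`. It takes values in the unit ball, which is enough because
the ball and sphere maxima agree. If `⟪x, y⟫ = τ²`, then `G x` and `G y` share a Gaussian component
and are otherwise independent, so `𝔼 ⟪δ(x), δ(y)⟫ = ‖T_τ φ‖²` with `T_τ` the Ornstein–Uhlenbeck
semigroup (`integral_inner_eq_integral_norm_mehler_sq`). Two estimates control this number:

* it is at most `q τ²`, `q = 𝔼 ‖φ‖²`, because `φ` is odd (`integral_norm_mehler_sq_le`);
* it is at least `c τ²`, `c = (𝔼 ⟪φ(u), u⟫)² / 4`, by projection onto linear functions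
  (`sq_integral_inner_id_mul_le`).

For small `ε` the numbers `q` and `c` are close to `1` and `9π/32`. Hence the matrix
`𝔼 ⟪δ(xᵢ), δ(xⱼ)⟫ - κ ⟪xᵢ, xⱼ⟫` has constant diagonal `q - κ` and no larger entry as soon as
`2 κ ≤ q + c`, and such matrices pair nonnegatively with diagonally dominant ones
(`IsSymmDiagDominant.sum_mul_nonneg`). With `κ = 0.9` the maximum over vectors is at most `10/9` times
the maximum over quaternions, and `10/9` is smaller than `1 + (1 - 9π/32) / α`.

The numerical value of that constant follows from `0.9667 ≤ α ≤ 0.9674`; these bounds come from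
Taylor polynomials of `1 / √(1 - z)` integrated term by term against `cos⁴`.
-/

noncomputable section

namespace QuatGrothendieck

/-! ### The value of the constant -/

lemma integral_sin_pow_add_two_half_pi (n : ℕ) :
    ∫ t in (0 : ℝ)..(Real.pi / 2), Real.sin t ^ (n + 2) =
      (n + 1) / (n + 2) * ∫ t in (0 : ℝ)..(Real.pi / 2), Real.sin t ^ n := by
  rw [integral_sin_pow]; simp

lemma integral_cos_pow_four_mul_sin_pow (n : ℕ) :
    ∫ t in (0 : ℝ)..(Real.pi / 2), Real.cos t ^ 4 * Real.sin t ^ n =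
      3 / ((n + 2) * (n + 4)) * ∫ t in (0 : ℝ)..(Real.pi / 2), Real.sin t ^ n := by
  have h : ∀ t : ℝ, Real.cos t ^ 4 * Real.sin t ^ n =
      Real.sin t ^ n - 2 * Real.sin t ^ (n + 2) + Real.sin t ^ (n + 2 + 2) := fun t => by
    have : Real.cos t ^ 4 = (1 - Real.sin t ^ 2) ^ 2 := by rw [← Real.cos_sq']; ring
    rw [this]; ring
  have hi : ∀ m : ℕ, IntervalIntegrable (fun t => Real.sin t ^ m) MeasureTheory.volume 0
      (Real.pi / 2) := fun m => (Real.continuous_sin.pow m).intervalIntegrable _ _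
  simp_rw [h]
  rw [intervalIntegral.integral_add ((hi _).sub ((hi _).const_mul _)) (hi _),
    intervalIntegral.integral_sub (hi _) ((hi _).const_mul _),
    intervalIntegral.integral_const_mul, integral_sin_pow_add_two_half_pi (n + 2),
    integral_sin_pow_add_two_half_pi n]
  push_cast
  have h2 : (n : ℝ) + 2 ≠ 0 := by positivity
  have h4 : (n : ℝ) + 2 + 2 ≠ 0 := by positivity
  have h4' : (n : ℝ) + 4 ≠ 0 := by positivity
  field_simp
  ring

lemma integral_cos_pow_four_mul_poly (a b c d e : ℝ) :
    ∫ t in (0 : ℝ)..(Real.pi / 2), Real.cos t ^ 4 * (a + b * Real.sin t ^ 2 + c * Real.sin t ^ 4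
      + d * Real.sin t ^ 6 + e * Real.sin t ^ 8) =
    3 * Real.pi / 16 * (a + b / 6 + c / 16 + d / 32 + e * (7 / 384)) := by
  have h : ∀ t : ℝ, Real.cos t ^ 4 * (a + b * Real.sin t ^ 2 + c * Real.sin t ^ 4
      + d * Real.sin t ^ 6 + e * Real.sin t ^ 8) =
      a * (Real.cos t ^ 4 * Real.sin t ^ 0) + b * (Real.cos t ^ 4 * Real.sin t ^ 2)
      + c * (Real.cos t ^ 4 * Real.sin t ^ 4) + d * (Real.cos t ^ 4 * Real.sin t ^ 6)
      + e * (Real.cos t ^ 4 * Real.sin t ^ 8) := fun t => by ring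
  have hi : ∀ (r : ℝ) (m : ℕ), IntervalIntegrable
      (fun t => r * (Real.cos t ^ 4 * Real.sin t ^ m)) MeasureTheory.volume 0 (Real.pi / 2) :=
    fun r m => (by fun_prop : Continuous
      (fun t => r * (Real.cos t ^ 4 * Real.sin t ^ m))).intervalIntegrable _ _
  have s0 : ∫ t in (0 : ℝ)..(Real.pi / 2), Real.sin t ^ 0 = Real.pi / 2 := by simp
  have s2 := integral_sin_pow_add_two_half_pi 0
  have s4 := integral_sin_pow_add_two_half_pi 2
  have s6 := integral_sin_pow_add_two_half_pi 4
  have s8 := integral_sin_pow_add_two_half_pi 6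
  rw [s0] at s2
  norm_num [-integral_sin_sq] at s2 s4 s6 s8
  simp_rw [h]
  rw [intervalIntegral.integral_add ((((hi _ _).add (hi _ _)).add (hi _ _)).add (hi _ _)) (hi _ _),
    intervalIntegral.integral_add (((hi _ _).add (hi _ _)).add (hi _ _)) (hi _ _),
    intervalIntegral.integral_add ((hi _ _).add (hi _ _)) (hi _ _),
    intervalIntegral.integral_add (hi _ _) (hi _ _)]
  simp only [intervalIntegral.integral_const_mul, integral_cos_pow_four_mul_sin_pow]
  rw [s0, s8, s6, s4, s2]
  push_cast
  ring

/-- The integrand of `haagerupP` is bounded by `cos³ ≤ 1`, also at `x = 1`, where its denominator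
vanishes at the right end of the interval. -/
lemma intervalIntegrable_haagerupP_integrand {x : ℝ} (hx : x ∈ Set.Icc (0 : ℝ) 1) :
    IntervalIntegrable (fun t => Real.cos t ^ 4 / Real.sqrt (1 - x ^ 2 * Real.sin t ^ 2))
      MeasureTheory.volume 0 (Real.pi / 2) := by
  refine (intervalIntegrable_const (c := (1 : ℝ))).mono_fun
    (Measurable.aestronglyMeasurable (by fun_prop)) (Filter.Eventually.of_forall fun t => ?_)
  have hc : Real.cos t ^ 2 ≤ 1 - x ^ 2 * Real.sin t ^ 2 := by
    rw [Real.cos_sq']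
    nlinarith [sq_nonneg (Real.sin t), hx.1, hx.2, mul_nonneg hx.1 (sub_nonneg.2 hx.2)]
  have h1 : |Real.cos t| ≤ Real.sqrt (1 - x ^ 2 * Real.sin t ^ 2) := Real.abs_le_sqrt hc
  have h4 : Real.cos t ^ 4 ≤ |Real.cos t| := by
    have : Real.cos t ^ 4 = |Real.cos t| ^ 4 := (Even.pow_abs (by decide) _).symm
    rw [this]
    exact pow_le_of_le_one (abs_nonneg _) (Real.abs_cos_le_one t) (by norm_num)
  simp only [norm_one]
  rw [Real.norm_of_nonneg (by positivity)]
  exact div_le_one_of_le₀ (h4.trans h1) (Real.sqrt_nonneg _)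

lemma taylor_le_inv_sqrt {z : ℝ} (h0 : 0 ≤ z) (h1 : z < 1) :
    1 + z / 2 + 3 / 8 * z ^ 2 ≤ (Real.sqrt (1 - z))⁻¹ := by
  have hs : 0 < Real.sqrt (1 - z) := Real.sqrt_pos.2 (by linarith)
  rw [← one_div, le_div_iff₀ hs, ← Real.sqrt_sq (show 0 ≤ 1 + z / 2 + 3 / 8 * z ^ 2 by positivity),
    ← Real.sqrt_mul (sq_nonneg _), Real.sqrt_le_one]
  have h : (1 + z / 2 + 3 / 8 * z ^ 2) ^ 2 * (1 - z) =
      1 - z ^ 3 * (5 / 8 + 15 / 64 * z + 9 / 64 * z ^ 2) := by ring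
  rw [h]
  have : 0 ≤ z ^ 3 * (5 / 8 + 15 / 64 * z + 9 / 64 * z ^ 2) := by positivity
  linarith

/-- The coefficient `2/5` exceeds the Taylor coefficient `35/128` by enough to absorb the tail of
the series on the given interval. -/
lemma inv_sqrt_le_taylor {z : ℝ} (h0 : 0 ≤ z) (h1 : z ≤ 81 / 256) :
    (Real.sqrt (1 - z))⁻¹ ≤ 1 + z / 2 + 3 / 8 * z ^ 2 + 5 / 16 * z ^ 3 + 2 / 5 * z ^ 4 := by
  have hs : 0 < Real.sqrt (1 - z) := Real.sqrt_pos.2 (by linarith)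
  set p := 1 + z / 2 + 3 / 8 * z ^ 2 + 5 / 16 * z ^ 3 + 2 / 5 * z ^ 4 with hp
  have hp0 : 0 ≤ p := by positivity
  rw [← one_div, div_le_iff₀ hs, ← Real.sqrt_sq hp0, ← Real.sqrt_mul (sq_nonneg _),
    Real.one_le_sqrt]
  have h : p ^ 2 * (1 - z) = 1 + z ^ 4 * (81 / 320 - (99 / 160 * z + 303 / 1280 * z ^ 2
      + 189 / 1280 * z ^ 3 + 9 / 100 * z ^ 4 + 4 / 25 * z ^ 5)) := by
    rw [hp]; ring
  have hb : 99 / 160 * z + 303 / 1280 * z ^ 2 + 189 / 1280 * z ^ 3 + 9 / 100 * z ^ 4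
      + 4 / 25 * z ^ 5 ≤ 99 / 160 * (81 / 256) + 303 / 1280 * (81 / 256) ^ 2
      + 189 / 1280 * (81 / 256) ^ 3 + 9 / 100 * (81 / 256) ^ 4 + 4 / 25 * (81 / 256) ^ 5 := by
    gcongr
  rw [h, le_add_iff_nonneg_right]
  refine mul_nonneg (by positivity) (sub_nonneg.2 (hb.trans (by norm_num)))

lemma taylor_le_haagerupP {x : ℝ} (hx : x ∈ Set.Icc (0 : ℝ) 1) :
    9 * Real.pi / 32 * (x + x ^ 3 / 12 + 3 / 128 * x ^ 5) ≤ haagerupP x := by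
  have h := integral_cos_pow_four_mul_poly 1 (x ^ 2 / 2) (3 / 8 * x ^ 4) 0 0
  have hle : ∫ t in (0 : ℝ)..(Real.pi / 2), Real.cos t ^ 4 * (1 + x ^ 2 / 2 * Real.sin t ^ 2
      + 3 / 8 * x ^ 4 * Real.sin t ^ 4 + 0 * Real.sin t ^ 6 + 0 * Real.sin t ^ 8) ≤
      ∫ t in (0 : ℝ)..(Real.pi / 2),
        Real.cos t ^ 4 / Real.sqrt (1 - x ^ 2 * Real.sin t ^ 2) := by
    refine intervalIntegral.integral_mono_on (by positivity)
      ((by fun_prop : Continuous _).intervalIntegrable _ _)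
      (intervalIntegrable_haagerupP_integrand hx) fun t _ => ?_
    rcases eq_or_ne (Real.cos t) 0 with h0 | h0
    · simp [h0]
    have hs : Real.sin t ^ 2 < 1 := by
      have := Real.sin_sq_add_cos_sq t
      have : 0 < Real.cos t ^ 2 := by positivity
      linarith
    have hz : x ^ 2 * Real.sin t ^ 2 < 1 :=
      (mul_le_of_le_one_left (sq_nonneg _) (pow_le_one₀ hx.1 hx.2)).trans_lt hs
    rw [div_eq_mul_inv]
    refine mul_le_mul_of_nonneg_left ?_ (by positivity)
    refine le_trans (le_of_eq ?_) (taylor_le_inv_sqrt (by positivity) hz)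
    ring
  rw [h] at hle
  have hx0 : 0 ≤ 3 * x / 2 := by linarith [hx.1]
  have := mul_le_mul_of_nonneg_left hle hx0
  rw [haagerupP]
  refine le_trans (le_of_eq ?_) this
  ring

lemma haagerupP_le_taylor {x : ℝ} (hx : x ∈ Set.Icc (0 : ℝ) (9 / 16)) :
    haagerupP x ≤ 9 * Real.pi / 32 * (x + x ^ 3 / 12 + 3 / 128 * x ^ 5 + 5 / 512 * x ^ 7
      + 7 / 960 * x ^ 9) := by
  have hx1 : x ∈ Set.Icc (0 : ℝ) 1 := ⟨hx.1, hx.2.trans (by norm_num)⟩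
  have h := integral_cos_pow_four_mul_poly 1 (x ^ 2 / 2) (3 / 8 * x ^ 4) (5 / 16 * x ^ 6)
    (2 / 5 * x ^ 8)
  have hle : ∫ t in (0 : ℝ)..(Real.pi / 2),
        Real.cos t ^ 4 / Real.sqrt (1 - x ^ 2 * Real.sin t ^ 2) ≤
      ∫ t in (0 : ℝ)..(Real.pi / 2), Real.cos t ^ 4 * (1 + x ^ 2 / 2 * Real.sin t ^ 2
      + 3 / 8 * x ^ 4 * Real.sin t ^ 4 + 5 / 16 * x ^ 6 * Real.sin t ^ 6
      + 2 / 5 * x ^ 8 * Real.sin t ^ 8) := by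
    refine intervalIntegral.integral_mono_on (by positivity)
      (intervalIntegrable_haagerupP_integrand hx1)
      ((by fun_prop : Continuous _).intervalIntegrable _ _) fun t _ => ?_
    have hz : x ^ 2 * Real.sin t ^ 2 ≤ 81 / 256 := by
      have h2 : x ^ 2 ≤ (9 / 16) ^ 2 := pow_le_pow_left₀ hx.1 hx.2 2
      exact (mul_le_of_le_one_right (sq_nonneg _) (Real.sin_sq_le_one t)).trans
        (h2.trans (by norm_num))
    rw [div_eq_mul_inv]
    refine mul_le_mul_of_nonneg_left ?_ (by positivity)
    refine (inv_sqrt_le_taylor (by positivity) hz).trans (le_of_eq ?_)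
    ring
  rw [h] at hle
  have hx0 : 0 ≤ 3 * x / 2 := by linarith [hx.1]
  have := mul_le_mul_of_nonneg_left hle hx0
  rw [haagerupP]
  refine this.trans (le_of_eq ?_)
  ring

lemma le_one_add_haagerupP_div {x : ℝ} (hx : x ∈ Set.Icc (0 : ℝ) 1) :
    0.9667 ≤ (1 + haagerupP x) / (1 + x) := by
  obtain ⟨h0, h1⟩ := hx
  rw [le_div_iff₀ (by linarith)]
  refine le_trans ?_ (add_le_add_right (taylor_le_haagerupP ⟨h0, h1⟩) 1)
  have hpi := Real.pi_gt_d4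
  have hp : 0 ≤ x + x ^ 3 / 12 + 3 / 128 * x ^ 5 := by positivity
  have hc : 0.8835 * (x + x ^ 3 / 12 + 3 / 128 * x ^ 5) ≤
      9 * Real.pi / 32 * (x + x ^ 3 / 12 + 3 / 128 * x ^ 5) :=
    mul_le_mul_of_nonneg_right (by linarith) hp
  -- tangent lines at `0.57`, close to the minimiser
  have t3 : 3 * 0.57 ^ 2 * x - 2 * 0.57 ^ 3 ≤ x ^ 3 := by
    nlinarith [mul_nonneg (sq_nonneg (x - 0.57)) (by linarith : 0 ≤ x + 2 * 0.57)]
  have t5 : 5 * 0.57 ^ 4 * x - 4 * 0.57 ^ 5 ≤ x ^ 5 := by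
    have : 0 ≤ (x - 0.57) ^ 2 *
        (x ^ 3 + 2 * 0.57 * x ^ 2 + 3 * 0.57 ^ 2 * x + 4 * 0.57 ^ 3) := by positivity
    nlinarith [this]
  norm_num at t3 t5 hc ⊢
  linarith

lemma alphaGW_bounds : 0.9667 ≤ alphaGW ∧ alphaGW ≤ 0.9674 := by
  have hne : ((fun x : ℝ => (1 + haagerupP x) / (1 + x)) '' Set.Icc 0 1).Nonempty :=
    ⟨_, 0, by simp, rfl⟩
  have hlow : ∀ r ∈ (fun x : ℝ => (1 + haagerupP x) / (1 + x)) '' Set.Icc 0 1, 0.9667 ≤ r := by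
    rintro _ ⟨x, hx, rfl⟩
    exact le_one_add_haagerupP_div hx
  refine ⟨le_csInf hne hlow, ?_⟩
  -- the infimum is attained close to `9 / 16`
  refine (csInf_le ⟨_, hlow⟩ ⟨9 / 16, by norm_num, rfl⟩).trans ?_
  have h := haagerupP_le_taylor (x := 9 / 16) (by norm_num)
  have hpi := Real.pi_lt_d4
  rw [div_le_iff₀ (by norm_num)]
  norm_num at h ⊢
  linarith

theorem abs_ddConstant_sub_lt : |ddConstant - 1.1204| < 0.00005 := by
  obtain ⟨h1, h2⟩ := alphaGW_bounds
  have hpi := Real.pi_gt_d6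
  have hpi' := Real.pi_lt_d6
  have hpos : 0 < alphaGW := by linarith
  have hlo : 0.12035 < (1 - 9 * Real.pi / 32) / alphaGW := by
    rw [lt_div_iff₀ hpos]; linarith
  have hhi : (1 - 9 * Real.pi / 32) / alphaGW < 0.12045 := by
    rw [div_lt_iff₀ hpos]; linarith
  rw [ddConstant, abs_lt]
  constructor <;> linarith

/-! ### Diagonally dominant forms on real inner product spaces -/

section RealForm

variable {n : ℕ} {A : Matrix (Fin n) (Fin n) ℝ}
  {E : Type*} [NormedAddCommGroup E] [InnerProductSpace ℝ E]

/-- If a matrix `d` has constant diagonal `c` and no entry exceeds `c` in absolute value, then it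
pairs nonnegatively with every diagonally dominant matrix. -/
lemma IsSymmDiagDominant.sum_mul_nonneg (hA : IsSymmDiagDominant A) {d : Fin n → Fin n → ℝ} {c : ℝ}
    (hd : ∀ i, d i i = c) (hle : ∀ i j, |d i j| ≤ c) : 0 ≤ ∑ i, ∑ j, A i j * d i j := by
  refine Finset.sum_nonneg fun i _ => ?_
  have hc : 0 ≤ c := (abs_nonneg _).trans (hle i i)
  rw [← Finset.add_sum_erase _ _ (Finset.mem_univ i), hd]
  have h1 : -∑ j ∈ Finset.univ.erase i, |A i j| * c ≤ ∑ j ∈ Finset.univ.erase i, A i j * d i j := by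
    rw [← Finset.sum_neg_distrib]
    refine Finset.sum_le_sum fun j _ => ?_
    have := mul_le_mul_of_nonneg_left (hle i j) (abs_nonneg (A i j))
    rw [← abs_mul] at this
    linarith [neg_abs_le (A i j * d i j)]
  rw [← Finset.sum_mul] at h1
  nlinarith [mul_le_mul_of_nonneg_right (hA.2 i) hc]

/-- The real bilinear form `∑ᵢⱼ a_ij ⟪xᵢ, yⱼ⟫` on families of vectors of a real inner product
space. -/
def realForm (A : Matrix (Fin n) (Fin n) ℝ) (x y : Fin n → E) : ℝ :=
  ∑ i, ∑ j, A i j * inner ℝ (x i) (y j)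

lemma IsSymmDiagDominant.realForm_comm (hA : IsSymmDiagDominant A) (x y : Fin n → E) :
    realForm A x y = realForm A y x := by
  rw [realForm, realForm, Finset.sum_comm]
  refine Finset.sum_congr rfl fun i _ => Finset.sum_congr rfl fun j _ => ?_
  rw [hA.1.apply, real_inner_comm]

/-- Diagonally dominant forms are positive semidefinite on families of vectors. -/
lemma IsSymmDiagDominant.realForm_self_nonneg (hA : IsSymmDiagDominant A) (x : Fin n → E) :
    0 ≤ realForm A x x := by
  -- by `2 |⟪xᵢ, xⱼ⟫| ≤ ‖xᵢ‖² + ‖xⱼ‖²` the form dominates `∑ᵢ (a_ii - ∑_{j ≠ i} |a_ij|) ‖xᵢ‖²`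
  set B : Fin n → Fin n → ℝ := fun i j => if i = j then A i i else -|A i j| with hB
  have hBs : ∀ i j, B i j = B j i := fun i j => by
    simp only [hB, eq_comm (a := j), hA.1.apply i j]
    split_ifs with h
    · rw [h]
    · rfl
  have hterm : ∀ i j, B i j * ((‖x i‖ ^ 2 + ‖x j‖ ^ 2) / 2) ≤ A i j * inner ℝ (x i) (x j) := by
    intro i j
    simp only [hB]
    split_ifs with h
    · subst h
      rw [real_inner_self_eq_norm_sq]
      linarith
    · have h1 : |inner ℝ (x i) (x j)| ≤ (‖x i‖ ^ 2 + ‖x j‖ ^ 2) / 2 := by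
        have := abs_real_inner_le_norm (x i) (x j)
        nlinarith [sq_nonneg (‖x i‖ - ‖x j‖)]
      have h2 := mul_le_mul_of_nonneg_left h1 (abs_nonneg (A i j))
      rw [← abs_mul] at h2
      linarith [neg_abs_le (A i j * inner ℝ (x i) (x j))]
  refine le_trans ?_ (Finset.sum_le_sum fun i _ => Finset.sum_le_sum fun j _ => hterm i j)
  have hsplit : ∑ i, ∑ j, B i j * ((‖x i‖ ^ 2 + ‖x j‖ ^ 2) / 2) =
      ∑ i, (∑ j, B i j) * ‖x i‖ ^ 2 := by
    have h1 : ∑ i, ∑ j, B i j * ‖x j‖ ^ 2 = ∑ i, ∑ j, B i j * ‖x i‖ ^ 2 := by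
      rw [Finset.sum_comm]
      exact Finset.sum_congr rfl fun i _ => Finset.sum_congr rfl fun j _ => by rw [hBs]
    have h2 : ∑ i, ∑ j, B i j * ((‖x i‖ ^ 2 + ‖x j‖ ^ 2) / 2) =
        (∑ i, ∑ j, B i j * ‖x i‖ ^ 2 + ∑ i, ∑ j, B i j * ‖x j‖ ^ 2) / 2 := by
      rw [← Finset.sum_add_distrib, Finset.sum_div]
      refine Finset.sum_congr rfl fun i _ => ?_
      rw [← Finset.sum_add_distrib, Finset.sum_div]
      exact Finset.sum_congr rfl fun j _ => by ring
    rw [h2, h1, add_self_div_two]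
    exact Finset.sum_congr rfl fun i _ => (Finset.sum_mul _ _ _).symm
  rw [hsplit]
  refine Finset.sum_nonneg fun i _ => mul_nonneg ?_ (sq_nonneg _)
  rw [← Finset.add_sum_erase _ _ (Finset.mem_univ i)]
  have h3 : ∑ j ∈ Finset.univ.erase i, B i j = -∑ j ∈ Finset.univ.erase i, |A i j| := by
    rw [← Finset.sum_neg_distrib]
    refine Finset.sum_congr rfl fun j hj => ?_
    simp [hB, (Finset.ne_of_mem_erase hj).symm]
  rw [h3]
  simp only [hB, if_true]
  linarith [hA.2 i]

lemma realForm_add_self (A : Matrix (Fin n) (Fin n) ℝ) (x y : Fin n → E) :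
    realForm A (x + y) (x + y) =
      realForm A x x + realForm A x y + realForm A y x + realForm A y y := by
  simp only [realForm, ← Finset.sum_add_distrib, Pi.add_apply, inner_add_left, inner_add_right]
  exact Finset.sum_congr rfl fun i _ => Finset.sum_congr rfl fun j _ => by ring

lemma realForm_sub_self (A : Matrix (Fin n) (Fin n) ℝ) (x y : Fin n → E) :
    realForm A (x - y) (x - y) =
      realForm A x x - realForm A x y - realForm A y x + realForm A y y := by
  simp only [realForm, ← Finset.sum_sub_distrib, ← Finset.sum_add_distrib, Pi.sub_apply,
    inner_sub_left, inner_sub_right]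
  exact Finset.sum_congr rfl fun i _ => Finset.sum_congr rfl fun j _ => by ring

lemma IsSymmDiagDominant.two_mul_realForm_le (hA : IsSymmDiagDominant A) (x y : Fin n → E) :
    2 * realForm A x y ≤ realForm A x x + realForm A y y := by
  have h := hA.realForm_self_nonneg (x - y)
  rw [realForm_sub_self, hA.realForm_comm y x] at h
  linarith

/-- Convexity of the form at midpoints, written for `x = ((x + w) + (x - w)) / 2`. -/
lemma IsSymmDiagDominant.two_mul_realForm_self_le (hA : IsSymmDiagDominant A) (x w : Fin n → E) :
    2 * realForm A x x ≤ realForm A (x + w) (x + w) + realForm A (x - w) (x - w) := by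
  have h := hA.realForm_self_nonneg w
  rw [realForm_sub_self, realForm_add_self]
  linarith

end RealForm

/-! ### Maxima of quaternionic forms -/

section Quaternionic

variable {n l : ℕ} {A : Matrix (Fin n) (Fin n) ℝ}

lemma re_qInner (x y : EuclideanSpace ℍ[ℝ] (Fin l)) : (qInner x y).re = inner ℝ x y := by
  have hre : ∀ f : Fin l → ℍ[ℝ], (∑ p, f p).re = ∑ p, (f p).re := fun f =>
    map_sum (⟨⟨fun q : ℍ[ℝ] => q.re, rfl⟩, fun _ _ => rfl⟩ : ℍ[ℝ] →+ ℝ) f _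
  rw [qInner, hre, PiLp.inner_apply]
  refine Finset.sum_congr rfl fun p _ => ?_
  rw [Quaternion.inner_def]
  simp

lemma star_qInner (x y : EuclideanSpace ℍ[ℝ] (Fin l)) : star (qInner x y) = qInner y x := by
  simp [qInner]

/-- Right multiplication by a quaternion on the right vector space `ℍ^l`. -/
def rightMul (x : EuclideanSpace ℍ[ℝ] (Fin l)) (u : ℍ[ℝ]) : EuclideanSpace ℍ[ℝ] (Fin l) :=
  WithLp.toLp 2 fun p => x p * u

lemma norm_rightMul (x : EuclideanSpace ℍ[ℝ] (Fin l)) (u : ℍ[ℝ]) :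
    ‖rightMul x u‖ = ‖x‖ * ‖u‖ := by
  rw [PiLp.norm_eq_of_L2, PiLp.norm_eq_of_L2]
  simp only [rightMul, norm_mul, mul_pow]
  rw [← Finset.sum_mul, Real.sqrt_mul' _ (sq_nonneg _), Real.sqrt_sq (norm_nonneg _)]

lemma qInner_rightMul (x y : EuclideanSpace ℍ[ℝ] (Fin l)) (u : ℍ[ℝ]) :
    qInner x (rightMul y u) = qInner x y * u := by
  simp [qInner, rightMul, Finset.sum_mul, mul_assoc]

lemma re_sum_smul_qInner (A : Matrix (Fin n) (Fin n) ℝ)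
    (x y : Fin n → EuclideanSpace ℍ[ℝ] (Fin l)) :
    (∑ i, ∑ j, A i j • qInner (x i) (y j)).re = realForm A x y := by
  have hre : ∀ f : Fin n → ℍ[ℝ], (∑ p, f p).re = ∑ p, (f p).re := fun f =>
    map_sum (⟨⟨fun q : ℍ[ℝ] => q.re, rfl⟩, fun _ _ => rfl⟩ : ℍ[ℝ] →+ ℝ) f _
  simp only [hre, Quaternion.re_smul, re_qInner, smul_eq_mul, realForm]

/-- On the diagonal the quaternionic form is self-adjoint, hence real, and it is nonnegative. -/
lemma IsSymmDiagDominant.vecForm_self (hA : IsSymmDiagDominant A)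
    (x : Fin n → EuclideanSpace ℍ[ℝ] (Fin l)) : vecForm A x x = realForm A x x := by
  set S := ∑ i, ∑ j, A i j • qInner (x i) (x j) with hS
  have hstar : star S = S := by
    rw [hS]
    simp only [star_sum, Quaternion.star_smul, star_qInner]
    rw [Finset.sum_comm]
    exact Finset.sum_congr rfl fun i _ => Finset.sum_congr rfl fun j _ => by rw [hA.1.apply]
  have hSre : S = ((S.re : ℝ) : ℍ[ℝ]) := Quaternion.star_eq_self.1 hstar
  rw [vecForm, ← hS, hSre, Quaternion.norm_coe, hS, re_sum_smul_qInner,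
    Real.norm_of_nonneg (hA.realForm_self_nonneg x)]

/-- A common right rotation of the `yⱼ` turns `∑ a_ij ⟨xᵢ, yⱼ⟩` into its absolute value. -/
lemma exists_realForm_rightMul_eq_vecForm (A : Matrix (Fin n) (Fin n) ℝ)
    (x y : Fin n → EuclideanSpace ℍ[ℝ] (Fin l)) :
    ∃ u : ℍ[ℝ], ‖u‖ = 1 ∧ realForm A x (fun j => rightMul (y j) u) = vecForm A x y := by
  set S := ∑ i, ∑ j, A i j • qInner (x i) (y j) with hS
  have key : ∀ u : ℍ[ℝ], realForm A x (fun j => rightMul (y j) u) = (S * u).re := fun u => by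
    rw [← re_sum_smul_qInner, hS]
    simp only [qInner_rightMul, Finset.sum_mul, smul_mul_assoc]
  rcases eq_or_ne S 0 with h0 | h0
  · refine ⟨1, norm_one, ?_⟩
    rw [key, vecForm, ← hS, h0]; simp
  · have hn : ‖S‖ ≠ 0 := norm_ne_zero_iff.2 h0
    refine ⟨‖S‖⁻¹ • star S, ?_, ?_⟩
    · rw [norm_smul, norm_star, norm_inv, norm_norm, inv_mul_cancel₀ hn]
    · rw [key, mul_smul_comm, Quaternion.self_mul_star, Quaternion.normSq_eq_norm_mul_self,
        Quaternion.re_smul, Quaternion.re_coe, smul_eq_mul, vecForm, ← hS]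
      field_simp

/-- Every vector of the unit ball of `ℍ^l`, `l ≥ 1`, is the midpoint of two unit vectors. -/
lemma exists_norm_add_eq_one_norm_sub_eq_one (hl : 0 < l) (x : EuclideanSpace ℍ[ℝ] (Fin l))
    (hx : ‖x‖ ≤ 1) : ∃ w, ‖x + w‖ = 1 ∧ ‖x - w‖ = 1 := by
  obtain ⟨e, he, hxe⟩ : ∃ e : EuclideanSpace ℍ[ℝ] (Fin l), ‖e‖ = 1 ∧ x = ‖x‖ • e := by
    rcases eq_or_ne x 0 with h0 | h0
    · exact ⟨WithLp.toLp 2 (Pi.single ⟨0, hl⟩ 1), by simp, by simp [h0]⟩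
    · refine ⟨‖x‖⁻¹ • x, ?_, ?_⟩
      · rw [norm_smul, norm_inv, norm_norm, inv_mul_cancel₀ (norm_ne_zero_iff.2 h0)]
      · rw [smul_smul, mul_inv_cancel₀ (norm_ne_zero_iff.2 h0), one_smul]
  -- rotate `e` by the unit quaternions `‖x‖ ± √(1 - ‖x‖²) i`
  set r := ‖x‖ with hr
  obtain ⟨I, hI0, hI1, hI2, hI3⟩ : ∃ I : ℍ[ℝ], I.re = 0 ∧ I.imI = 1 ∧ I.imJ = 0 ∧ I.imK = 0 :=
    ⟨⟨0, 1, 0, 0⟩, rfl, rfl, rfl, rfl⟩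
  have hs : 0 ≤ 1 - r ^ 2 := by nlinarith [norm_nonneg x]
  have hnorm : ∀ s : ℝ, s ^ 2 = 1 - r ^ 2 → ‖x + rightMul e (s • I)‖ = 1 := by
    intro s hs2
    have h1 : x + rightMul e (s • I) = rightMul e ((r : ℍ[ℝ]) + s • I) := by
      rw [hxe]
      ext p : 1
      simp [rightMul, mul_add, Quaternion.mul_coe_eq_smul]
    have h2 : ‖(r : ℍ[ℝ]) + s • I‖ ^ 2 = 1 := by
      rw [sq, ← Quaternion.normSq_eq_norm_mul_self, Quaternion.normSq_def']
      simp [hI0, hI1, hI2, hI3]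
      linarith
    rw [h1, norm_rightMul, he, one_mul]
    exact (pow_eq_one_iff_of_nonneg (norm_nonneg _) two_ne_zero).1 h2
  refine ⟨rightMul e (Real.sqrt (1 - r ^ 2) • I), hnorm _ (Real.sq_sqrt hs), ?_⟩
  have h3 : x - rightMul e (Real.sqrt (1 - r ^ 2) • I) =
      x + rightMul e (-Real.sqrt (1 - r ^ 2) • I) := by
    ext p : 1
    simp [rightMul, sub_eq_add_neg]
  rw [h3]
  exact hnorm _ (by rw [neg_sq, Real.sq_sqrt hs])

lemma continuous_realForm_self {E : Type*} [NormedAddCommGroup E] [InnerProductSpace ℝ E]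
    (A : Matrix (Fin n) (Fin n) ℝ) : Continuous fun x : Fin n → E => realForm A x x := by
  unfold realForm
  fun_prop

/-- The maxima over unit vectors, over the unit balls and over pairs of families of unit vectors
exist and coincide. -/
lemma IsSymmDiagDominant.exists_isGreatest (hA : IsSymmDiagDominant A) (hl : 0 < l) :
    ∃ M, IsGreatest (vecSphereValues A l) M ∧ IsGreatest (vecBallValues A l) M ∧
      IsGreatest (vecPairValues A l) M := by
  have : ProperSpace (EuclideanSpace ℍ[ℝ] (Fin l)) := FiniteDimensional.proper_real _
  have hcomp : IsCompact (Set.univ.pi fun _ : Fin n =>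
      Metric.sphere (0 : EuclideanSpace ℍ[ℝ] (Fin l)) 1) :=
    isCompact_univ_pi fun _ => isCompact_sphere _ _
  obtain ⟨x, hx, hmax⟩ := hcomp.exists_isMaxOn
    ⟨fun _ => WithLp.toLp 2 (Pi.single ⟨0, hl⟩ 1), by simp [Set.mem_pi]⟩
    (continuous_realForm_self A).continuousOn
  have hx1 : ∀ i, ‖x i‖ = 1 := fun i => by simpa using hx i (Set.mem_univ i)
  have hM : ∀ y : Fin n → EuclideanSpace ℍ[ℝ] (Fin l), (∀ i, ‖y i‖ = 1) →
      realForm A y y ≤ realForm A x x := fun y hy => hmax (by simpa [Set.mem_pi] using hy)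
  refine ⟨realForm A x x, ⟨⟨x, hx1, (hA.vecForm_self x).symm⟩, ?_⟩,
    ⟨⟨x, fun i => (hx1 i).le, (hA.vecForm_self x).symm⟩, ?_⟩,
    ⟨⟨x, x, hx1, hx1, (hA.vecForm_self x).symm⟩, ?_⟩⟩
  · rintro _ ⟨y, hy, rfl⟩
    rw [hA.vecForm_self]
    exact hM y hy
  · rintro _ ⟨y, hy, rfl⟩
    rw [hA.vecForm_self]
    choose w hw1 hw2 using fun i => exists_norm_add_eq_one_norm_sub_eq_one hl (y i) (hy i)
    have h1 := hM (y + w) hw1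
    have h2 := hM (y - w) hw2
    linarith [hA.two_mul_realForm_self_le y w]
  · rintro _ ⟨y, z, hy, hz, rfl⟩
    obtain ⟨u, hu, h⟩ := exists_realForm_rightMul_eq_vecForm A y z
    rw [← h]
    have h1 := hM y hy
    have h2 := hM (fun j => rightMul (z j) u) fun j => by rw [norm_rightMul, hz, hu, one_mul]
    linarith [hA.two_mul_realForm_le y fun j => rightMul (z j) u]

/-- A quaternion as a vector of `ℍ^1`. -/
def toVec (q : ℍ[ℝ]) : EuclideanSpace ℍ[ℝ] (Fin 1) := WithLp.toLp 2 fun _ => q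

lemma norm_toVec (q : ℍ[ℝ]) : ‖toVec q‖ = ‖q‖ := by simp [toVec, PiLp.norm_eq_of_L2]

lemma toVec_apply_zero (x : EuclideanSpace ℍ[ℝ] (Fin 1)) : toVec (x 0) = x := by
  ext i : 1
  simp [toVec, Subsingleton.elim i 0]

lemma vecForm_toVec (A : Matrix (Fin n) (Fin n) ℝ) (δ ε : Fin n → ℍ[ℝ]) :
    vecForm A (fun i => toVec (δ i)) (fun j => toVec (ε j)) = scalForm A δ ε := by
  simp [vecForm, scalForm, qInner, toVec]

lemma scalForm_apply_zero (A : Matrix (Fin n) (Fin n) ℝ)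
    (x y : Fin n → EuclideanSpace ℍ[ℝ] (Fin 1)) :
    scalForm A (fun i => x i 0) (fun j => y j 0) = vecForm A x y := by
  simp only [← vecForm_toVec, toVec_apply_zero]

lemma norm_apply_zero (x : EuclideanSpace ℍ[ℝ] (Fin 1)) : ‖x 0‖ = ‖x‖ := by
  rw [← norm_toVec, toVec_apply_zero]

lemma scalSphereValues_eq (A : Matrix (Fin n) (Fin n) ℝ) :
    scalSphereValues A = vecSphereValues A 1 := by
  ext r
  constructor
  · rintro ⟨δ, h, rfl⟩
    exact ⟨fun i => toVec (δ i), by simpa [norm_toVec] using h, (vecForm_toVec A δ δ).symm⟩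
  · rintro ⟨x, h, rfl⟩
    exact ⟨fun i => x i 0, by simpa [norm_apply_zero] using h, (scalForm_apply_zero A x x).symm⟩

lemma scalBallValues_eq (A : Matrix (Fin n) (Fin n) ℝ) :
    scalBallValues A = vecBallValues A 1 := by
  ext r
  constructor
  · rintro ⟨δ, h, rfl⟩
    exact ⟨fun i => toVec (δ i), by simpa [norm_toVec] using h, (vecForm_toVec A δ δ).symm⟩
  · rintro ⟨x, h, rfl⟩
    exact ⟨fun i => x i 0, by simpa [norm_apply_zero] using h, (scalForm_apply_zero A x x).symm⟩

lemma scalPairValues_eq (A : Matrix (Fin n) (Fin n) ℝ) :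
    scalPairValues A = vecPairValues A 1 := by
  ext r
  constructor
  · rintro ⟨δ, ε, h, h', rfl⟩
    exact ⟨fun i => toVec (δ i), fun i => toVec (ε i), by simpa [norm_toVec] using h,
      by simpa [norm_toVec] using h', (vecForm_toVec A δ ε).symm⟩
  · rintro ⟨x, y, h, h', rfl⟩
    exact ⟨fun i => x i 0, fun i => y i 0, by simpa [norm_apply_zero] using h,
      by simpa [norm_apply_zero] using h', (scalForm_apply_zero A x y).symm⟩

end Quaternionic

open MeasureTheory ProbabilityTheory

/-! ### Laws of correlated Gaussian pairs -/

lemma norm_smul_add_smul_sq {V : Type*} [NormedAddCommGroup V] [InnerProductSpace ℝ V]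
    (a b : ℝ) (p q : V) :
    ‖a • p + b • q‖ ^ 2 = a ^ 2 * ‖p‖ ^ 2 + 2 * (a * b) * inner ℝ p q + b ^ 2 * ‖q‖ ^ 2 := by
  rw [norm_add_sq_real, norm_smul, norm_smul, real_inner_smul_left, real_inner_smul_right,
    mul_pow, mul_pow, Real.norm_eq_abs, Real.norm_eq_abs, sq_abs, sq_abs]
  ring

section Laws

variable {V : Type*} [NormedAddCommGroup V] [InnerProductSpace ℝ V] [FiniteDimensional ℝ V]
  [MeasurableSpace V] [BorelSpace V]

/-- `μ` is the law of a pair of standard Gaussian vectors of `V` with correlation `t`, i.e. its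
characteristic function is `exp (-(‖p‖² + 2 t ⟪p, q⟫ + ‖q‖²) / 2)`. -/
def IsCorrelatedPair (μ : Measure (V × V)) (t : ℝ) : Prop :=
  ∀ p q : V, charFunDual μ ((innerSL ℝ p).coprod (innerSL ℝ q)) =
    Complex.exp (-((‖p‖ ^ 2 + 2 * t * inner ℝ p q + ‖q‖ ^ 2 : ℝ) : ℂ) / 2)

lemma IsCorrelatedPair.eq {μ ν : Measure (V × V)} [IsFiniteMeasure μ] [IsFiniteMeasure ν] {t : ℝ}
    (hμ : IsCorrelatedPair μ t) (hν : IsCorrelatedPair ν t) : μ = ν := by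
  refine Measure.ext_of_charFunDual (funext fun M => ?_)
  obtain ⟨p, hp⟩ := (InnerProductSpace.toDual ℝ V).surjective (M.comp (.inl ℝ V V))
  obtain ⟨q, hq⟩ := (InnerProductSpace.toDual ℝ V).surjective (M.comp (.inr ℝ V V))
  have hM : M = (innerSL ℝ p).coprod (innerSL ℝ q) := by
    ext v
    · simpa using (DFunLike.congr_fun hp v).symm
    · simpa using (DFunLike.congr_fun hq v).symm
  rw [hM, hμ, hν]

lemma charFunDual_stdGaussian_innerSL (p : V) :
    charFunDual (stdGaussian V) (innerSL ℝ p) = Complex.exp (-((‖p‖ ^ 2 : ℝ) : ℂ) / 2) := by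
  rw [charFunDual_stdGaussian, innerSL_apply_norm]
  push_cast
  rfl

/-- Two linear combinations of independent standard Gaussian vectors, with coefficient vectors
`x` and `y` of norm one. -/
lemma isCorrelatedPair_map_pi {ι : Type*} [Fintype ι] {x y : ι → ℝ} {t : ℝ}
    (hx : ∑ k, x k ^ 2 = 1) (hy : ∑ k, y k ^ 2 = 1) (hxy : ∑ k, x k * y k = t) :
    IsCorrelatedPair ((Measure.pi fun _ : ι => stdGaussian V).map
      fun g => (∑ k, x k • g k, ∑ k, y k • g k)) t := by
  classical
  intro p q
  let T : (ι → V) →L[ℝ] V × V :=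
    (∑ k, x k • ContinuousLinearMap.proj k).prod (∑ k, y k • ContinuousLinearMap.proj k)
  have hT : (fun g : ι → V => (∑ k, x k • g k, ∑ k, y k • g k)) = T := by
    ext g <;> simp [T]
  have hk : ∀ k, ((((innerSL ℝ p).coprod (innerSL ℝ q)).comp T).comp
      (ContinuousLinearMap.single ℝ (fun _ : ι => V) k)) = innerSL ℝ (x k • p + y k • q) := by
    intro k
    ext v
    simp [T, Pi.single_apply]
  rw [hT, charFunDual_map, charFunDual_pi]
  simp only [hk, charFunDual_stdGaussian_innerSL]
  rw [← Complex.exp_sum]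
  congr 1
  rw [← Finset.sum_div, Finset.sum_neg_distrib, ← Complex.ofReal_sum]
  congr 4
  simp only [norm_smul_add_smul_sq, Finset.sum_add_distrib, ← Finset.sum_mul, ← Finset.mul_sum]
  rw [hx, hy, hxy]
  ring

lemma isCorrelatedPair_map_prod {a b c d t : ℝ} (h1 : a ^ 2 + b ^ 2 = 1) (h2 : c ^ 2 + d ^ 2 = 1)
    (h : a * c + b * d = t) :
    IsCorrelatedPair (((stdGaussian V).prod (stdGaussian V)).map
      fun z : V × V => (a • z.1 + b • z.2, c • z.1 + d • z.2)) t := by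
  intro p q
  let T : V × V →L[ℝ] V × V :=
    (a • ContinuousLinearMap.fst ℝ V V + b • ContinuousLinearMap.snd ℝ V V).prod
      (c • ContinuousLinearMap.fst ℝ V V + d • ContinuousLinearMap.snd ℝ V V)
  have hT : (fun z : V × V => (a • z.1 + b • z.2, c • z.1 + d • z.2)) = T := by
    ext g <;> simp [T]
  have hl : (((innerSL ℝ p).coprod (innerSL ℝ q)).comp T).comp (.inl ℝ V V) =
      innerSL ℝ (a • p + c • q) := by
    ext v
    simp [T]
  have hr : (((innerSL ℝ p).coprod (innerSL ℝ q)).comp T).comp (.inr ℝ V V) =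
      innerSL ℝ (b • p + d • q) := by
    ext v
    simp [T]
  rw [hT, charFunDual_map, charFunDual_prod, hl, hr, charFunDual_stdGaussian_innerSL,
    charFunDual_stdGaussian_innerSL, ← Complex.exp_add, ← add_div, ← neg_add, ← Complex.ofReal_add,
    norm_smul_add_smul_sq, norm_smul_add_smul_sq]
  congr 4
  linear_combination ‖p‖ ^ 2 * h1 + ‖q‖ ^ 2 * h2 + 2 * inner ℝ p q * h

/-- Two standard Gaussian vectors sharing the component `w` and otherwise independent. -/
lemma isCorrelatedPair_map_prod_prod {τ σ : ℝ} (h : τ ^ 2 + σ ^ 2 = 1) :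
    IsCorrelatedPair (((stdGaussian V).prod ((stdGaussian V).prod (stdGaussian V))).map
      fun z : V × V × V => (τ • z.1 + σ • z.2.1, τ • z.1 + σ • z.2.2)) (τ ^ 2) := by
  intro p q
  let T : V × V × V →L[ℝ] V × V :=
    (τ • ContinuousLinearMap.fst ℝ V (V × V) + σ • (ContinuousLinearMap.fst ℝ V V).comp
      (ContinuousLinearMap.snd ℝ V (V × V))).prod
    (τ • ContinuousLinearMap.fst ℝ V (V × V) + σ • (ContinuousLinearMap.snd ℝ V V).comp
      (ContinuousLinearMap.snd ℝ V (V × V)))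
  have hT : (fun z : V × V × V => (τ • z.1 + σ • z.2.1, τ • z.1 + σ • z.2.2)) = T := by
    ext g <;> simp [T]
  have h0 : (((innerSL ℝ p).coprod (innerSL ℝ q)).comp T).comp (.inl ℝ V (V × V)) =
      innerSL ℝ (τ • p + τ • q) := by
    ext v
    simp [T]
  have h1 : ((((innerSL ℝ p).coprod (innerSL ℝ q)).comp T).comp (.inr ℝ V (V × V))).comp
      (.inl ℝ V V) = innerSL ℝ (σ • p) := by
    ext v
    simp [T]
  have h2 : ((((innerSL ℝ p).coprod (innerSL ℝ q)).comp T).comp (.inr ℝ V (V × V))).comp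
      (.inr ℝ V V) = innerSL ℝ (σ • q) := by
    ext v
    simp [T]
  rw [hT, charFunDual_map, charFunDual_prod, charFunDual_prod, h0, h1, h2,
    charFunDual_stdGaussian_innerSL, charFunDual_stdGaussian_innerSL,
    charFunDual_stdGaussian_innerSL, ← Complex.exp_add, ← Complex.exp_add, ← add_div, ← add_div,
    ← neg_add, ← neg_add, ← Complex.ofReal_add, ← Complex.ofReal_add, norm_smul_add_smul_sq,
    norm_smul, norm_smul, mul_pow, mul_pow, Real.norm_eq_abs, sq_abs]
  congr 4
  linear_combination (‖p‖ ^ 2 + ‖q‖ ^ 2) * h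

end Laws

/-- The Cauchy–Schwarz inequality for square integrable vector-valued functions. -/
lemma sq_integral_inner_le {Ω V : Type*} [MeasurableSpace Ω] {μ : Measure Ω}
    [NormedAddCommGroup V] [InnerProductSpace ℝ V] {f g : Ω → V}
    (hf : Integrable (fun ω => ‖f ω‖ ^ 2) μ) (hg : Integrable (fun ω => ‖g ω‖ ^ 2) μ)
    (hfg : Integrable (fun ω => inner ℝ (f ω) (g ω)) μ) :
    (∫ ω, inner ℝ (f ω) (g ω) ∂μ) ^ 2 ≤ (∫ ω, ‖f ω‖ ^ 2 ∂μ) * ∫ ω, ‖g ω‖ ^ 2 ∂μ := by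
  -- the quadratic polynomial `s ↦ ∫ ‖f + s g‖²` is nonnegative
  have key : ∀ s : ℝ, 0 ≤ (∫ ω, ‖g ω‖ ^ 2 ∂μ) * (s * s) + (2 * ∫ ω, inner ℝ (f ω) (g ω) ∂μ) * s
      + ∫ ω, ‖f ω‖ ^ 2 ∂μ := by
    intro s
    have h : ∫ ω, ‖f ω + s • g ω‖ ^ 2 ∂μ = (∫ ω, ‖g ω‖ ^ 2 ∂μ) * (s * s)
        + (2 * ∫ ω, inner ℝ (f ω) (g ω) ∂μ) * s + ∫ ω, ‖f ω‖ ^ 2 ∂μ := by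
      have h1 : ∀ ω, ‖f ω + s • g ω‖ ^ 2 =
          s * s * ‖g ω‖ ^ 2 + 2 * s * inner ℝ (f ω) (g ω) + ‖f ω‖ ^ 2 := fun ω => by
        rw [norm_add_sq_real, norm_smul, real_inner_smul_right, mul_pow, Real.norm_eq_abs, sq_abs]
        ring
      simp_rw [h1]
      have h2 : Integrable
          (fun ω => s * s * ‖g ω‖ ^ 2 + 2 * s * inner ℝ (f ω) (g ω)) μ :=
        (hg.const_mul _).add (hfg.const_mul _)
      rw [integral_add h2 hf,
        integral_add (hg.const_mul _) (hfg.const_mul _), integral_const_mul, integral_const_mul]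
      ring
    rw [← h]
    positivity
  have := discrim_le_zero key
  rw [discrim] at this
  nlinarith

/-! ### The Ornstein–Uhlenbeck semigroup -/

/-- A continuous function bounded by one in norm is integrable against a probability measure. -/
lemma integrable_of_norm_le_one {X E : Type*} [TopologicalSpace X] [MeasurableSpace X]
    [OpensMeasurableSpace X] [SecondCountableTopology X] [NormedAddCommGroup E]
    [SecondCountableTopology E]
    {μ : Measure X} [IsProbabilityMeasure μ] {f : X → E} (hf : Continuous f)
    (hb : ∀ x, ‖f x‖ ≤ 1) : Integrable f μ :=
  (integrable_const (1 : ℝ)).mono' hf.aestronglyMeasurable (Filter.Eventually.of_forall hb)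

lemma norm_inner_le_one {V : Type*} [NormedAddCommGroup V] [InnerProductSpace ℝ V] {x y : V}
    (hx : ‖x‖ ≤ 1) (hy : ‖y‖ ≤ 1) : ‖inner ℝ x y‖ ≤ 1 :=
  (norm_inner_le_norm x y).trans (mul_le_one₀ hx (norm_nonneg _) hy)

lemma norm_sq_le_one {V : Type*} [NormedAddCommGroup V] {x : V} (hx : ‖x‖ ≤ 1) : ‖‖x‖ ^ 2‖ ≤ 1 := by
  rw [norm_pow, norm_norm]
  exact pow_le_one₀ (norm_nonneg _) hx

section Mehler

variable {V : Type*} [NormedAddCommGroup V] [InnerProductSpace ℝ V] [FiniteDimensional ℝ V]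
  [MeasurableSpace V] [BorelSpace V] {φ : V → V}

/-- The Mehler (Ornstein–Uhlenbeck) average `w ↦ 𝔼 φ(τ w + √(1 - τ²) a)` of `φ` over a standard
Gaussian vector `a`. -/
def mehler (φ : V → V) (τ : ℝ) (w : V) : V :=
  ∫ a, φ (τ • w + Real.sqrt (1 - τ ^ 2) • a) ∂(stdGaussian V)

lemma norm_mehler_le_one (hb : ∀ u, ‖φ u‖ ≤ 1) (τ : ℝ) (w : V) : ‖mehler φ τ w‖ ≤ 1 := by
  have := norm_integral_le_of_norm_le_const (μ := stdGaussian V)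
    (Filter.Eventually.of_forall fun a => hb (τ • w + Real.sqrt (1 - τ ^ 2) • a))
  simpa [mehler] using this

lemma continuous_mehler (hc : Continuous φ) (hb : ∀ u, ‖φ u‖ ≤ 1) (τ : ℝ) :
    Continuous (mehler φ τ) := by
  unfold mehler
  exact continuous_of_dominated (bound := fun _ => 1)
    (fun w => Continuous.aestronglyMeasurable (by fun_prop))
    (fun w => Filter.Eventually.of_forall fun a => hb _) (integrable_const _)
    (Filter.Eventually.of_forall fun a => by fun_prop)

/-- The semigroup identity `⟨φ, T_{τ²} φ⟩ = ‖T_τ φ‖²`: conditionally on their common component, two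
vectors of correlation `τ²` are independent. -/
lemma integral_inner_eq_integral_norm_mehler_sq (hc : Continuous φ) (hb : ∀ u, ‖φ u‖ ≤ 1)
    {μ : Measure (V × V)} [IsFiniteMeasure μ] {τ : ℝ} (hτ : τ ^ 2 ≤ 1)
    (hμ : IsCorrelatedPair μ (τ ^ 2)) :
    ∫ z, inner ℝ (φ z.1) (φ z.2) ∂μ = ∫ w, ‖mehler φ τ w‖ ^ 2 ∂(stdGaussian V) := by
  rw [hμ.eq (isCorrelatedPair_map_prod_prod (σ := Real.sqrt (1 - τ ^ 2))
    (by rw [Real.sq_sqrt (by linarith)]; ring)),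
    integral_map (by fun_prop) (Continuous.aestronglyMeasurable (by fun_prop)),
    integral_prod _ (integrable_of_norm_le_one (by fun_prop)
      fun z => norm_inner_le_one (hb _) (hb _))]
  refine integral_congr_ae (Filter.Eventually.of_forall fun w => ?_)
  have hi : Integrable (fun a => φ (τ • w + Real.sqrt (1 - τ ^ 2) • a)) (stdGaussian V) :=
    integrable_of_norm_le_one (by fun_prop) fun _ => hb _
  simp only
  rw [integral_prod _ (integrable_of_norm_le_one (by fun_prop)
      fun z => norm_inner_le_one (hb _) (hb _)), ← real_inner_self_eq_norm_sq]
  simp only [integral_inner hi]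
  rw [← mehler]
  simp only [real_inner_comm (mehler φ τ w)]
  rw [integral_inner hi, ← mehler]

/-- Conditioning on the first vector of the pair turns the correlation of `φ` into `⟨φ, T_t φ⟩`. -/
lemma integral_inner_mehler_eq (hc : Continuous φ) (hb : ∀ u, ‖φ u‖ ≤ 1)
    {μ : Measure (V × V)} [IsFiniteMeasure μ] {t : ℝ} (ht : t ^ 2 ≤ 1)
    (hμ : IsCorrelatedPair μ t) :
    ∫ z, inner ℝ (φ z.1) (φ z.2) ∂μ = ∫ w, inner ℝ (φ w) (mehler φ t w) ∂(stdGaussian V) := by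
  rw [hμ.eq (isCorrelatedPair_map_prod (a := 1) (b := 0) (c := t) (d := Real.sqrt (1 - t ^ 2))
    (by ring) (by rw [Real.sq_sqrt (by linarith)]; ring) (by ring)),
    integral_map (by fun_prop) (Continuous.aestronglyMeasurable (by fun_prop)),
    integral_prod _ (integrable_of_norm_le_one (by fun_prop)
      fun z => norm_inner_le_one (hb _) (hb _))]
  refine integral_congr_ae (Filter.Eventually.of_forall fun w => ?_)
  have hi : Integrable (fun a => φ (t • w + Real.sqrt (1 - t ^ 2) • a)) (stdGaussian V) :=
    integrable_of_norm_le_one (by fun_prop) fun _ => hb _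
  simp only [one_smul, zero_smul, add_zero]
  rw [integral_inner hi, ← mehler]

/-- Pairs with any correlation in `[-1, 1]` exist. -/
lemma exists_isCorrelatedPair {t : ℝ} (ht : t ^ 2 ≤ 1) :
    ∃ μ : Measure (V × V), IsProbabilityMeasure μ ∧ IsCorrelatedPair μ t :=
  ⟨_, Measure.isProbabilityMeasure_map (by fun_prop), isCorrelatedPair_map_prod (a := 1) (b := 0)
    (c := t) (d := Real.sqrt (1 - t ^ 2)) (by ring) (by rw [Real.sq_sqrt (by linarith)]; ring)
    (by ring)⟩

/-- The Cauchy–Schwarz inequality for `⟨φ, T_{t²} φ⟩ = ‖T_t φ‖²`. -/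
lemma sq_integral_norm_mehler_sq_le (hc : Continuous φ) (hb : ∀ u, ‖φ u‖ ≤ 1) {t : ℝ}
    (ht : t ^ 2 ≤ 1) :
    (∫ w, ‖mehler φ t w‖ ^ 2 ∂(stdGaussian V)) ^ 2 ≤
      (∫ w, ‖φ w‖ ^ 2 ∂(stdGaussian V)) * ∫ w, ‖mehler φ (t ^ 2) w‖ ^ 2 ∂(stdGaussian V) := by
  have ht2 : (t ^ 2) ^ 2 ≤ 1 := pow_le_one₀ (sq_nonneg _) ht
  obtain ⟨μ, _, hμ⟩ := exists_isCorrelatedPair (V := V) ht2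
  rw [← integral_inner_eq_integral_norm_mehler_sq hc hb ht hμ,
    integral_inner_mehler_eq hc hb ht2 hμ]
  have hm := continuous_mehler hc hb (t ^ 2)
  exact sq_integral_inner_le
    (integrable_of_norm_le_one (by fun_prop) fun w => norm_sq_le_one (hb w))
    (integrable_of_norm_le_one (by fun_prop) fun w => norm_sq_le_one (norm_mehler_le_one hb _ w))
    (integrable_of_norm_le_one (by fun_prop)
      fun w => norm_inner_le_one (hb w) (norm_mehler_le_one hb _ w))

lemma integral_stdGaussian_comp_neg {E : Type*} [NormedAddCommGroup E] [NormedSpace ℝ E]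
    (f : V → E) : ∫ a, f (-a) ∂(stdGaussian V) = ∫ a, f a ∂(stdGaussian V) := by
  have h := stdGaussian_map (LinearIsometryEquiv.neg ℝ (E := V))
  conv_rhs => rw [← h]
  rw [show ⇑(LinearIsometryEquiv.neg ℝ (E := V)) =
    (LinearIsometryEquiv.neg ℝ (E := V)).toHomeomorph from rfl,
    (Homeomorph.measurableEmbedding _).integral_map]
  rfl

/-- Oddness of `φ` gives `T_t φ(w) = 𝔼 (φ(t w + s a) - φ(-t w + s a)) / 2`, a difference of values
at distance `2 t ‖w‖`. -/
lemma norm_mehler_le (hc : Continuous φ) (hb : ∀ u, ‖φ u‖ ≤ 1) (hodd : ∀ u, φ (-u) = -φ u)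
    {L : ℝ} (hL : ∀ u v, ‖φ u - φ v‖ ≤ L * ‖u - v‖) {t : ℝ} (ht : 0 ≤ t) (w : V) :
    ‖mehler φ t w‖ ≤ L * (t * ‖w‖) := by
  set s := Real.sqrt (1 - t ^ 2)
  have hi : ∀ r : ℝ, Integrable (fun a => φ (r • w + s • a)) (stdGaussian V) := fun r =>
    integrable_of_norm_le_one (by fun_prop) fun _ => hb _
  have h1 : mehler φ t w = -∫ a, φ ((-t) • w + s • a) ∂(stdGaussian V) := by
    rw [← integral_neg, mehler, ← integral_stdGaussian_comp_neg]
    refine integral_congr_ae (Filter.Eventually.of_forall fun a => ?_)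
    simp only [← hodd]
    congr 1
    simp only [neg_smul, smul_neg, neg_add, neg_neg, s]
  have h2 : (2 : ℝ) • mehler φ t w =
      ∫ a, (φ (t • w + s • a) - φ ((-t) • w + s • a)) ∂(stdGaussian V) := by
    rw [integral_sub (hi t) (hi (-t)), two_smul, sub_eq_add_neg, ← h1]
    rfl
  have h3 : ‖(2 : ℝ) • mehler φ t w‖ ≤ 2 * (L * (t * ‖w‖)) := by
    rw [h2]
    have h4 : ∀ a, ‖φ (t • w + s • a) - φ ((-t) • w + s • a)‖ ≤ 2 * (L * (t * ‖w‖)) := fun a => by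
      refine (hL _ _).trans (le_of_eq ?_)
      have : t • w + s • a - ((-t) • w + s • a) = (2 * t) • w := by module
      rw [this, norm_smul, Real.norm_of_nonneg (by positivity)]
      ring
    simpa using norm_integral_le_of_norm_le_const (μ := stdGaussian V)
      (Filter.Eventually.of_forall h4)
  rw [norm_smul, Real.norm_of_nonneg zero_le_two] at h3
  linarith

/-- The spectral gap (Poincaré inequality) of the Ornstein–Uhlenbeck semigroup on odd functions.
Writing `h t = ‖T_t φ‖²`, the inequality `h(t)² ≤ h(1) h(t²)` is iterated towards `t = 0`, where
`h(t) = O(t²)` because `φ` is odd and Lipschitz. -/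
lemma integral_norm_mehler_sq_le (hc : Continuous φ) (hb : ∀ u, ‖φ u‖ ≤ 1)
    (hodd : ∀ u, φ (-u) = -φ u) {L : ℝ} (hL : ∀ u v, ‖φ u - φ v‖ ≤ L * ‖u - v‖)
    (hint : Integrable (fun w : V => ‖w‖ ^ 2) (stdGaussian V))
    (hq : 0 < ∫ w, ‖φ w‖ ^ 2 ∂(stdGaussian V)) {t : ℝ} (ht : 0 ≤ t) (ht1 : t ≤ 1) :
    ∫ w, ‖mehler φ t w‖ ^ 2 ∂(stdGaussian V) ≤ (∫ w, ‖φ w‖ ^ 2 ∂(stdGaussian V)) * t ^ 2 := by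
  set q := ∫ w, ‖φ w‖ ^ 2 ∂(stdGaussian V)
  set h : ℝ → ℝ := fun t => ∫ w, ‖mehler φ t w‖ ^ 2 ∂(stdGaussian V) with hh
  set C := L ^ 2 * ∫ w : V, ‖w‖ ^ 2 ∂(stdGaussian V) with hC
  have hnn : ∀ s, 0 ≤ h s := fun s => integral_nonneg fun w => sq_nonneg _
  have hsmall : ∀ s, 0 ≤ s → h s ≤ C * s ^ 2 := fun s hs => by
    have h1 : h s ≤ ∫ w : V, (L ^ 2 * s ^ 2) * ‖w‖ ^ 2 ∂(stdGaussian V) := by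
      refine integral_mono_of_nonneg (Filter.Eventually.of_forall fun w => sq_nonneg _)
        (hint.const_mul _) (Filter.Eventually.of_forall fun w => ?_)
      refine (pow_le_pow_left₀ (norm_nonneg _) (norm_mehler_le hc hb hodd hL hs w) 2).trans
        (le_of_eq ?_)
      ring
    rw [integral_const_mul] at h1
    rw [hC]
    linarith
  have hiter : ∀ k : ℕ, (h t / q) ^ (2 ^ k) ≤ h (t ^ (2 ^ k)) / q := by
    intro k
    induction k with
    | zero => simp
    | succ k ih =>
      have hk1 : (t ^ 2 ^ k) ^ 2 ≤ 1 := pow_le_one₀ (by positivity) (pow_le_one₀ ht ht1)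
      have h2 := sq_integral_norm_mehler_sq_le hc hb hk1
      have h3 : (h (t ^ 2 ^ k) / q) ^ 2 ≤ h ((t ^ 2 ^ k) ^ 2) / q := by
        rw [div_pow, div_le_div_iff₀ (by positivity) hq]
        have := mul_le_mul_of_nonneg_right h2 hq.le
        simp only [hh]
        linarith
      rw [pow_succ, pow_mul, pow_mul t]
      exact (pow_le_pow_left₀ (pow_nonneg (div_nonneg (hnn _) hq.le) _) ih 2).trans h3
  rcases ht.eq_or_lt with h0 | h0
  · have := hsmall t ht
    rw [← h0] at this ⊢
    simpa [hh] using this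
  have ht2 : 0 < t ^ 2 := by positivity
  have hbound : ∀ k : ℕ, (h t / (q * t ^ 2)) ^ (2 ^ k) ≤ C / q := fun k => by
    rw [← div_div, div_pow, div_le_iff₀ (by positivity)]
    refine (hiter k).trans ?_
    rw [div_mul_eq_mul_div]
    refine div_le_div_of_nonneg_right ((hsmall _ (by positivity)).trans (le_of_eq ?_)) hq.le
    rw [← pow_mul, ← pow_mul, mul_comm 2]
  have hle : h t / (q * t ^ 2) ≤ 1 := by
    by_contra! hlt
    obtain ⟨m, hm⟩ := pow_unbounded_of_one_lt (C / q) hlt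
    have := (hbound m).trans_lt hm
    exact absurd (pow_le_pow_right₀ hlt.le (Nat.lt_two_pow_self (n := m)).le) (not_le.2 this)
  rwa [div_le_one (by positivity)] at hle

/-- Projection of `T_τ φ` onto the linear functions bounds its norm from below. -/
lemma sq_integral_inner_id_mul_le (hc : Continuous φ) (hb : ∀ u, ‖φ u‖ ≤ 1)
    (hint : Integrable (fun w : V => ‖w‖ ^ 2) (stdGaussian V)) {τ : ℝ} (hτ : τ ^ 2 ≤ 1) :
    (∫ w, inner ℝ (φ w) w ∂(stdGaussian V)) ^ 2 * τ ^ 2 ≤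
      (∫ w, ‖mehler φ τ w‖ ^ 2 ∂(stdGaussian V)) * ∫ w : V, ‖w‖ ^ 2 ∂(stdGaussian V) := by
  set σ := Real.sqrt (1 - τ ^ 2) with hσ
  have hσ2 : τ ^ 2 + σ ^ 2 = 1 := by rw [hσ, Real.sq_sqrt (by linarith)]; ring
  have hid : Integrable (fun w : V => w) (stdGaussian V) := IsGaussian.integrable_id
  have hn : Integrable (fun w : V => ‖w‖) (stdGaussian V) := hid.norm
  have hm := continuous_mehler hc hb τ
  have hbd : ∀ (x w : V), ‖x‖ ≤ 1 → ‖inner ℝ x w‖ ≤ ‖w‖ := fun x w hx =>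
    (norm_inner_le_norm x w).trans (mul_le_of_le_one_left (norm_nonneg _) hx)
  have hI : Integrable (fun z : V × V => inner ℝ (φ (τ • z.1 + σ • z.2)) z.1)
      ((stdGaussian V).prod (stdGaussian V)) :=
    (hn.comp_fst (stdGaussian V)).mono' (Continuous.aestronglyMeasurable (by fun_prop))
      (Filter.Eventually.of_forall fun z => hbd _ _ (hb _))
  have hJ : Integrable (fun z : V × V => inner ℝ (φ z.1) (τ • z.1 + σ • z.2))
      ((stdGaussian V).prod (stdGaussian V)) :=
    (((hn.comp_fst (stdGaussian V)).const_mul |τ|).add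
      ((hn.comp_snd (stdGaussian V)).const_mul |σ|)).mono'
      (Continuous.aestronglyMeasurable (by fun_prop))
      (Filter.Eventually.of_forall fun z => (hbd _ _ (hb _)).trans
        ((norm_add_le _ _).trans (by rw [norm_smul, norm_smul]; rfl)))
  -- `(τ w + σ a, w)` and `(w, τ w + σ a)` have the same law
  have hlaw := (isCorrelatedPair_map_prod (V := V) (a := τ) (b := σ) (c := 1) (d := 0) (t := τ)
    hσ2 (by ring) (by ring)).eq (isCorrelatedPair_map_prod (V := V) (a := 1) (b := 0) (c := τ)
      (d := σ) (by ring) hσ2 (by ring))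
  have h1 : ∫ w, inner ℝ (mehler φ τ w) w ∂(stdGaussian V) =
      τ * ∫ w, inner ℝ (φ w) w ∂(stdGaussian V) := by
    have h2 := congrArg (fun μ : Measure (V × V) => ∫ z, inner ℝ (φ z.1) z.2 ∂μ) hlaw
    rw [integral_map (by fun_prop) (Continuous.aestronglyMeasurable (by fun_prop)),
      integral_map (by fun_prop) (Continuous.aestronglyMeasurable (by fun_prop))] at h2
    simp only [one_smul, zero_smul, add_zero] at h2
    rw [integral_prod _ hI, integral_prod _ hJ] at h2
    rw [← integral_const_mul]
    refine Eq.trans (integral_congr_ae (Filter.Eventually.of_forall fun w => ?_))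
      (h2.trans (integral_congr_ae (Filter.Eventually.of_forall fun w => ?_)))
    · simp only
      simp_rw [real_inner_comm w]
      rw [integral_inner (integrable_of_norm_le_one (by fun_prop) fun _ => hb _)]
      rfl
    · have h3 : ∫ y, (τ • w + σ • y) ∂(stdGaussian V) = τ • w := by
        have h5 : Integrable (fun y : V => σ • y) (stdGaussian V) := hid.smul σ
        rw [integral_add (integrable_const _) h5, integral_smul σ, integral_id_stdGaussian]
        simp
      have h4 : Integrable (fun y => τ • w + σ • y) (stdGaussian V) :=
        (integrable_const _).add (hid.smul σ)
      simp only
      rw [integral_inner h4, h3, real_inner_smul_right]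
  have h2 := sq_integral_inner_le (f := mehler φ τ) (g := fun w => w) (μ := stdGaussian V)
    (integrable_of_norm_le_one (by fun_prop) fun w => norm_sq_le_one (norm_mehler_le_one hb _ w))
    hint (hn.mono' (Continuous.aestronglyMeasurable (by fun_prop))
      (Filter.Eventually.of_forall fun w => hbd _ _ (norm_mehler_le_one hb _ w)))
  rw [h1, mul_pow] at h2
  linarith

end Mehler

/-! ### Radial Gaussian moments in dimension four -/

section Radial

lemma integral_rpow_mul_exp_neg_half_sq {k : ℝ} (hk : -1 < k) :
    ∫ r in Set.Ioi (0 : ℝ), r ^ k * Real.exp (-(1 / 2) * r ^ 2) =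
      2 ^ ((k + 1) / 2) / 2 * Real.Gamma ((k + 1) / 2) := by
  have h := integral_rpow_mul_exp_neg_mul_rpow (p := 2) (q := k) (b := 1 / 2) two_pos hk
    (by norm_num)
  simp only [Real.rpow_two] at h
  rw [h, one_div, Real.inv_rpow zero_le_two, ← Real.rpow_neg zero_le_two]
  congr 2
  ring_nf

lemma integral_pow_two_mul_exp :
    ∫ r in Set.Ioi (0 : ℝ), r ^ 2 * Real.exp (-(1 / 2) * r ^ 2) = Real.sqrt (2 * Real.pi) / 2 := by
  have h := integral_rpow_mul_exp_neg_half_sq (k := 2) (by norm_num)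
  have h1 : (2 : ℝ) ^ ((2 + 1) / 2 : ℝ) = 2 * Real.sqrt 2 := by
    rw [show ((2 : ℝ) + 1) / 2 = 1 + 1 / 2 by norm_num, Real.rpow_add two_pos, Real.rpow_one,
      Real.sqrt_eq_rpow]
  have h2 : Real.Gamma ((2 + 1) / 2) = Real.sqrt Real.pi / 2 := by
    rw [show ((2 : ℝ) + 1) / 2 = 1 / 2 + 1 by norm_num, Real.Gamma_add_one (by norm_num),
      Real.Gamma_one_half_eq]
    ring
  rw [h1, h2] at h
  simp only [Real.rpow_two] at h
  rw [h, Real.sqrt_mul zero_le_two]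
  ring

lemma integral_pow_three_mul_exp :
    ∫ r in Set.Ioi (0 : ℝ), r ^ 3 * Real.exp (-(1 / 2) * r ^ 2) = 2 := by
  have h := integral_rpow_mul_exp_neg_half_sq (k := (3 : ℕ)) (by norm_num)
  rw [show (((3 : ℕ) : ℝ) + 1) / 2 = ((1 : ℕ) : ℝ) + 1 by norm_num,
    Real.Gamma_nat_eq_factorial] at h
  simp only [Real.rpow_natCast] at h
  rw [h]
  norm_num

lemma integral_pow_four_mul_exp :
    ∫ r in Set.Ioi (0 : ℝ), r ^ 4 * Real.exp (-(1 / 2) * r ^ 2) =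
      3 / 2 * Real.sqrt (2 * Real.pi) := by
  have h := integral_rpow_mul_exp_neg_half_sq (k := (4 : ℕ)) (by norm_num)
  have h1 : (2 : ℝ) ^ ((((4 : ℕ) : ℝ) + 1) / 2 : ℝ) = 4 * Real.sqrt 2 := by
    rw [show (((4 : ℕ) : ℝ) + 1) / 2 = (2 : ℕ) + 1 / 2 by norm_num, Real.rpow_add two_pos,
      Real.rpow_natCast, Real.sqrt_eq_rpow]
    norm_num
  have h2 : Real.Gamma ((((4 : ℕ) : ℝ) + 1) / 2) = 3 / 4 * Real.sqrt Real.pi := by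
    rw [show (((4 : ℕ) : ℝ) + 1) / 2 = 1 / 2 + 1 + 1 by norm_num, Real.Gamma_add_one (by norm_num),
      Real.Gamma_add_one (by norm_num), Real.Gamma_one_half_eq]
    ring
  rw [h1, h2] at h
  simp only [Real.rpow_natCast] at h
  rw [h, Real.sqrt_mul zero_le_two]
  ring

lemma integral_pow_five_mul_exp :
    ∫ r in Set.Ioi (0 : ℝ), r ^ 5 * Real.exp (-(1 / 2) * r ^ 2) = 8 := by
  have h := integral_rpow_mul_exp_neg_half_sq (k := (5 : ℕ)) (by norm_num)
  rw [show (((5 : ℕ) : ℝ) + 1) / 2 = ((2 : ℕ) : ℝ) + 1 by norm_num,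
    Real.Gamma_nat_eq_factorial] at h
  simp only [Real.rpow_natCast] at h
  rw [h]
  norm_num

lemma integrableOn_pow_mul_exp (k : ℕ) :
    IntegrableOn (fun r : ℝ => r ^ k * Real.exp (-(1 / 2) * r ^ 2)) (Set.Ioi 0) := by
  have h := integrableOn_rpow_mul_exp_neg_mul_sq (b := 1 / 2) (by norm_num) (s := k)
    (by have := k.cast_nonneg (α := ℝ); linarith)
  simpa only [Real.rpow_natCast] using h

/-- The standard Gaussian measure of `ℝ⁴` has density `(2π)⁻² exp(-‖x‖² / 2)`. -/
lemma stdGaussian_eq_withDensity : stdGaussian (EuclideanSpace ℝ (Fin 4)) =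
    volume.withDensity fun x => ENNReal.ofReal
      (((2 * Real.pi) ^ 2)⁻¹ * Real.exp (-(1 / 2) * ‖x‖ ^ 2)) := by
  have hint : Integrable fun x : EuclideanSpace ℝ (Fin 4) =>
      ((2 * Real.pi) ^ 2)⁻¹ * Real.exp (-(1 / 2) * ‖x‖ ^ 2) := by
    refine Integrable.const_mul ?_ _
    by_contra hn
    have h := GaussianFourier.integral_rexp_neg_mul_sq_norm (V := EuclideanSpace ℝ (Fin 4))
      (b := 1 / 2) (by norm_num)
    rw [integral_undef hn] at h
    exact absurd h (by positivity)
  have : IsFiniteMeasure ((volume : Measure (EuclideanSpace ℝ (Fin 4))).withDensity fun x =>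
      ENNReal.ofReal (((2 * Real.pi) ^ 2)⁻¹ * Real.exp (-(1 / 2) * ‖x‖ ^ 2))) :=
    isFiniteMeasure_withDensity_ofReal hint.2
  refine Measure.ext_of_charFun (funext fun t => ?_)
  rw [charFun_stdGaussian, charFun_apply,
    integral_withDensity_eq_integral_toReal_smul (by fun_prop)
      (Filter.Eventually.of_forall fun _ => ENNReal.ofReal_lt_top)]
  have h := GaussianFourier.integral_cexp_neg_mul_sq_norm_add (V := EuclideanSpace ℝ (Fin 4))
    (b := 1 / 2) (by norm_num) Complex.I t
  have h2 : ∀ x : EuclideanSpace ℝ (Fin 4),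
      (ENNReal.ofReal (((2 * Real.pi) ^ 2)⁻¹ * Real.exp (-(1 / 2) * ‖x‖ ^ 2))).toReal •
        Complex.exp (inner ℝ x t * Complex.I) = (((2 * Real.pi) ^ 2)⁻¹ : ℝ) *
        Complex.exp (-(1 / 2) * ‖x‖ ^ 2 + Complex.I * inner ℝ t x) := fun x => by
    rw [ENNReal.toReal_ofReal (by positivity), Complex.exp_add, real_inner_comm, Complex.real_smul]
    push_cast
    ring_nf
  simp_rw [h2]
  rw [integral_const_mul, h, finrank_euclideanSpace_fin]
  have h3 : ((Real.pi : ℂ) / (1 / 2)) ^ (((4 : ℕ) : ℂ) / 2) = (2 * Real.pi) ^ 2 := by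
    rw [show (((4 : ℕ) : ℂ) / 2) = ((2 : ℕ) : ℂ) by norm_num, Complex.cpow_natCast]
    ring
  have h4 : (Complex.I ^ 2 * (‖t‖ : ℂ) ^ 2 / (4 * (1 / 2))) = -(‖t‖ : ℂ) ^ 2 / 2 := by
    rw [Complex.I_sq]; ring
  have h5 : (2 * (Real.pi : ℂ)) ^ 2 ≠ 0 := by
    simp [Real.pi_ne_zero]
  rw [h3, h4]
  push_cast
  rw [← mul_assoc, inv_mul_cancel₀ h5, one_mul]

/-- Radial integrals against the standard Gaussian measure of `ℝ⁴`. -/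
lemma integral_fun_norm_stdGaussian (f : ℝ → ℝ) :
    ∫ x, f ‖x‖ ∂(stdGaussian (EuclideanSpace ℝ (Fin 4))) =
      1 / 2 * ∫ r in Set.Ioi (0 : ℝ), f r * (r ^ 3 * Real.exp (-(1 / 2) * r ^ 2)) := by
  obtain ⟨K, hK⟩ : ∃ K : ℝ, ∀ f : ℝ → ℝ, ∫ x, f ‖x‖ ∂(stdGaussian (EuclideanSpace ℝ (Fin 4))) =
      K * ∫ r in Set.Ioi (0 : ℝ), f r * (r ^ 3 * Real.exp (-(1 / 2) * r ^ 2)) := by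
    refine ⟨4 * ((volume : Measure (EuclideanSpace ℝ (Fin 4))).real (Metric.ball 0 1) *
      ((2 * Real.pi) ^ 2)⁻¹), fun f => ?_⟩
    rw [stdGaussian_eq_withDensity, integral_withDensity_eq_integral_toReal_smul (by fun_prop)
      (Filter.Eventually.of_forall fun _ => ENNReal.ofReal_lt_top)]
    have h := integral_fun_norm_addHaar (volume : Measure (EuclideanSpace ℝ (Fin 4)))
      fun r => (ENNReal.ofReal (((2 * Real.pi) ^ 2)⁻¹ * Real.exp (-(1 / 2) * r ^ 2))).toReal • f r
    rw [h, finrank_euclideanSpace_fin]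
    simp only [nsmul_eq_mul, smul_eq_mul, mul_assoc]
    congr 2
    rw [← integral_const_mul]
    refine integral_congr_ae (Filter.Eventually.of_forall fun r => ?_)
    simp only
    rw [ENNReal.toReal_ofReal (by positivity)]
    push_cast
    ring
  -- the total mass determines the constant
  have h1 := hK fun _ => 1
  simp only [one_mul, integral_pow_three_mul_exp, integral_const, probReal_univ, smul_eq_mul] at h1
  rw [hK f, show K = 1 / 2 by linarith]

lemma integral_norm_sq_stdGaussian :
    ∫ x, ‖x‖ ^ 2 ∂(stdGaussian (EuclideanSpace ℝ (Fin 4))) = 4 := by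
  rw [integral_fun_norm_stdGaussian fun r => r ^ 2]
  simp only [← mul_assoc, ← pow_add]
  rw [integral_pow_five_mul_exp]
  norm_num

end Radial

/-! ### The rounding function -/

section SoftSign

variable {V : Type*} [NormedAddCommGroup V] [InnerProductSpace ℝ V]

/-- A Lipschitz approximation of the direction `u / ‖u‖` of a vector. The shift `1 / 100` is small
enough for the moments of the Gaussian image to exceed what the constant `0.9` requires. -/
def softSign (u : V) : V := (‖u‖ + 1 / 100)⁻¹ • u

lemma norm_softSign (u : V) : ‖softSign u‖ = ‖u‖ / (‖u‖ + 1 / 100) := by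
  rw [softSign, norm_smul, norm_inv, Real.norm_of_nonneg (by positivity)]
  ring

lemma norm_softSign_le_one (u : V) : ‖softSign u‖ ≤ 1 := by
  rw [norm_softSign]
  exact div_le_one_of_le₀ (by linarith) (by positivity)

lemma softSign_neg (u : V) : softSign (-u) = -softSign u := by simp [softSign]

lemma inner_softSign_self (u : V) : inner ℝ (softSign u) u = ‖u‖ ^ 2 / (‖u‖ + 1 / 100) := by
  rw [softSign, real_inner_smul_left, real_inner_self_eq_norm_sq]
  ring

lemma norm_softSign_sub_le (u v : V) : ‖softSign u - softSign v‖ ≤ 200 * ‖u - v‖ := by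
  have hu : 0 < ‖u‖ + 1 / 100 := by positivity
  have hv : 0 < ‖v‖ + 1 / 100 := by positivity
  have h : softSign u - softSign v =
      (‖u‖ + 1 / 100)⁻¹ • (u - v) + ((‖u‖ + 1 / 100)⁻¹ * (‖v‖ - ‖u‖)) • softSign v := by
    have h1 : (‖u‖ + 1 / 100)⁻¹ - (‖v‖ + 1 / 100)⁻¹ =
        (‖u‖ + 1 / 100)⁻¹ * (‖v‖ - ‖u‖) * (‖v‖ + 1 / 100)⁻¹ := by field_simp; ring
    rw [softSign, softSign, smul_smul, ← h1]
    module
  have hinv : (‖u‖ + 1 / 100)⁻¹ ≤ 100 := by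
    rw [inv_le_comm₀ hu (by norm_num)]
    linarith [norm_nonneg u]
  rw [h]
  refine (norm_add_le _ _).trans ?_
  rw [norm_smul, norm_smul, norm_mul, norm_inv, Real.norm_of_nonneg hu.le]
  have h2 : ‖‖v‖ - ‖u‖‖ ≤ ‖u - v‖ := by
    rw [norm_sub_rev u v]
    exact abs_norm_sub_norm_le v u
  have h3 : (‖u‖ + 1 / 100)⁻¹ * ‖u - v‖ ≤ 100 * ‖u - v‖ :=
    mul_le_mul_of_nonneg_right hinv (norm_nonneg _)
  have h4 : (‖u‖ + 1 / 100)⁻¹ * ‖‖v‖ - ‖u‖‖ * ‖softSign v‖ ≤ 100 * ‖u - v‖ := by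
    have h5 : (‖u‖ + 1 / 100)⁻¹ * ‖‖v‖ - ‖u‖‖ ≤ 100 * ‖u - v‖ :=
      mul_le_mul hinv h2 (norm_nonneg _) (by norm_num)
    exact (mul_le_of_le_one_right (by positivity) (norm_softSign_le_one v)).trans h5
  linarith

lemma continuous_softSign : Continuous (softSign : V → V) := by
  unfold softSign
  exact ((continuous_norm.add continuous_const).inv₀ fun u =>
    ne_of_gt (show 0 < ‖u‖ + 1 / 100 by positivity)).smul continuous_id

lemma sqrt_two_mul_pi_bounds :
    2.5 ≤ Real.sqrt (2 * Real.pi) ∧ Real.sqrt (2 * Real.pi) ≤ 2.6 := by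
  constructor
  · exact Real.le_sqrt_of_sq_le (by nlinarith [Real.pi_gt_d2])
  · exact Real.sqrt_le_iff.2 ⟨by norm_num, by nlinarith [Real.pi_lt_d2]⟩

lemma le_integral_norm_softSign_sq :
    0.98 ≤ ∫ x, ‖softSign x‖ ^ 2 ∂(stdGaussian (EuclideanSpace ℝ (Fin 4))) := by
  simp only [norm_softSign]
  rw [integral_fun_norm_stdGaussian fun r => (r / (r + 1 / 100)) ^ 2]
  have h3 := integrableOn_pow_mul_exp 3
  have h2 := integrableOn_pow_mul_exp 2
  have hle : ∫ r in Set.Ioi (0 : ℝ), (r ^ 3 * Real.exp (-(1 / 2) * r ^ 2)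
      - 1 / 50 * (r ^ 2 * Real.exp (-(1 / 2) * r ^ 2))) ≤
      ∫ r in Set.Ioi (0 : ℝ), (r / (r + 1 / 100)) ^ 2 *
        (r ^ 3 * Real.exp (-(1 / 2) * r ^ 2)) := by
    refine setIntegral_mono_on (h3.sub (h2.const_mul _)) (h3.mono'
      (Measurable.aestronglyMeasurable (by fun_prop)) ?_) measurableSet_Ioi fun r hr => ?_
    · refine (ae_restrict_iff' measurableSet_Ioi).2 (Filter.Eventually.of_forall fun r hr => ?_)
      have hr0 : 0 < r := hr
      rw [Real.norm_of_nonneg (by positivity)]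
      exact mul_le_of_le_one_left (by positivity)
        (pow_le_one₀ (by positivity) (div_le_one_of_le₀ (by linarith) (by positivity)))
    · have hr0 : 0 < r := hr
      -- Bernoulli's inequality for `r / (r + 1 / 100)`
      have h1 : 1 - 1 / 50 / r ≤ (r / (r + 1 / 100)) ^ 2 := by
        rw [div_pow, le_div_iff₀ (by positivity)]
        have : (1 - 1 / 50 / r) * (r + 1 / 100) ^ 2 =
            r ^ 2 - (3 / 10000 + 1 / 500000 / r) := by field_simp; ring
        rw [this]
        have : 0 < 3 / 10000 + 1 / 500000 / r := by positivity
        linarith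
      refine le_trans (le_of_eq ?_) (mul_le_mul_of_nonneg_right h1
        (by positivity : 0 ≤ r ^ 3 * Real.exp (-(1 / 2) * r ^ 2)))
      field_simp
  rw [integral_sub h3 (h2.const_mul _), integral_const_mul, integral_pow_three_mul_exp,
    integral_pow_two_mul_exp] at hle
  linarith [sqrt_two_mul_pi_bounds.2]

lemma le_integral_inner_softSign_self :
    1.85 ≤ ∫ x, inner ℝ (softSign x) x ∂(stdGaussian (EuclideanSpace ℝ (Fin 4))) := by
  simp only [inner_softSign_self]
  rw [integral_fun_norm_stdGaussian fun r => r ^ 2 / (r + 1 / 100)]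
  have h4 := integrableOn_pow_mul_exp 4
  have h3 := integrableOn_pow_mul_exp 3
  have hle : ∫ r in Set.Ioi (0 : ℝ), (r ^ 4 * Real.exp (-(1 / 2) * r ^ 2)
      - 1 / 100 * (r ^ 3 * Real.exp (-(1 / 2) * r ^ 2))) ≤
      ∫ r in Set.Ioi (0 : ℝ), r ^ 2 / (r + 1 / 100) *
        (r ^ 3 * Real.exp (-(1 / 2) * r ^ 2)) := by
    refine setIntegral_mono_on (h4.sub (h3.const_mul _)) (h4.mono'
      (Measurable.aestronglyMeasurable (by fun_prop)) ?_) measurableSet_Ioi fun r hr => ?_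
    · refine (ae_restrict_iff' measurableSet_Ioi).2 (Filter.Eventually.of_forall fun r hr => ?_)
      have hr0 : 0 < r := hr
      rw [Real.norm_of_nonneg (by positivity)]
      have h1 : r ^ 2 / (r + 1 / 100) ≤ r := by
        rw [div_le_iff₀ (by positivity)]
        nlinarith
      refine (mul_le_mul_of_nonneg_right h1 (by positivity)).trans (le_of_eq ?_)
      ring
    · have hr0 : 0 < r := hr
      have h1 : r - 1 / 100 ≤ r ^ 2 / (r + 1 / 100) := by
        rw [le_div_iff₀ (by positivity)]
        nlinarith
      refine le_trans (le_of_eq ?_) (mul_le_mul_of_nonneg_right h1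
        (by positivity : 0 ≤ r ^ 3 * Real.exp (-(1 / 2) * r ^ 2)))
      ring
  rw [integral_sub h4 (h3.const_mul _), integral_const_mul, integral_pow_three_mul_exp,
    integral_pow_four_mul_exp] at hle
  linarith [sqrt_two_mul_pi_bounds.1]

end SoftSign

/-! ### Gaussian rounding -/

section Rounding

variable {ι : Type*} [Fintype ι]

/-- The linear image `∑ₖ xₖ gₖ` in `ℝ⁴` of a coefficient vector `x` under a family of vectors
`g`, i.e. under the matrix with columns `gₖ`. -/
def linComb (x : ι → ℝ) (g : ι → EuclideanSpace ℝ (Fin 4)) : EuclideanSpace ℝ (Fin 4) :=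
  ∑ k, x k • g k

lemma continuous_linComb (x : ι → ℝ) : Continuous (linComb x) := by
  unfold linComb
  fun_prop

lemma linComb_neg (x : ι → ℝ) (g : ι → EuclideanSpace ℝ (Fin 4)) :
    linComb (-x) g = -linComb x g := by
  simp [linComb]

/-- The law of the Gaussian matrix: independent standard Gaussian columns. -/
def columnLaw (ι : Type*) [Fintype ι] : Measure (ι → EuclideanSpace ℝ (Fin 4)) :=
  Measure.pi fun _ => stdGaussian (EuclideanSpace ℝ (Fin 4))

instance : IsProbabilityMeasure (columnLaw ι) := by
  unfold columnLaw
  infer_instance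

/-- The correlation `𝔼 ⟪δ(x), δ(y)⟫` of the randomly rounded vectors `δ(x) = softSign (G x)`. -/
def roundedCorr (x y : ι → ℝ) : ℝ :=
  ∫ g, inner ℝ (softSign (linComb x g)) (softSign (linComb y g)) ∂(columnLaw ι)

lemma integrable_roundedCorr (x y : ι → ℝ) :
    Integrable (fun g => inner ℝ (softSign (linComb x g)) (softSign (linComb y g)))
      (columnLaw ι) :=
  integrable_of_norm_le_one
    ((continuous_softSign.comp (continuous_linComb x)).inner
      (continuous_softSign.comp (continuous_linComb y)))
    fun _ => norm_inner_le_one (norm_softSign_le_one _) (norm_softSign_le_one _)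

lemma roundedCorr_neg (x y : ι → ℝ) : roundedCorr x (-y) = -roundedCorr x y := by
  simp only [roundedCorr, linComb_neg, softSign_neg, inner_neg_right, integral_neg]

lemma roundedCorr_eq {x y : ι → ℝ} (hx : ∑ k, x k ^ 2 = 1) (hy : ∑ k, y k ^ 2 = 1) {τ : ℝ}
    (hτ : τ ^ 2 ≤ 1) (hxy : ∑ k, x k * y k = τ ^ 2) :
    roundedCorr x y =
      ∫ w, ‖mehler softSign τ w‖ ^ 2 ∂(stdGaussian (EuclideanSpace ℝ (Fin 4))) := by
  have hlaw := isCorrelatedPair_map_pi (V := EuclideanSpace ℝ (Fin 4)) hx hy hxy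
  have hs := continuous_softSign (V := EuclideanSpace ℝ (Fin 4))
  rw [← integral_inner_eq_integral_norm_mehler_sq continuous_softSign norm_softSign_le_one hτ hlaw,
    integral_map (by fun_prop) (Continuous.aestronglyMeasurable (by fun_prop))]
  rfl

/-- The second moment of the rounded vectors. -/
def roundedNormSq : ℝ := ∫ x, ‖softSign x‖ ^ 2 ∂(stdGaussian (EuclideanSpace ℝ (Fin 4)))

lemma roundedCorr_self {x : ι → ℝ} (hx : ∑ k, x k ^ 2 = 1) :
    roundedCorr x x = roundedNormSq := by
  rw [roundedCorr_eq (τ := 1) hx hx (by norm_num) (by simpa [sq] using hx), roundedNormSq]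
  simp [mehler]

/-- For unit vectors of correlation `t ≥ 0` the rounded correlation lies between `0.85 t` and
`roundedNormSq * t`. -/
lemma roundedCorr_bounds {x y : ι → ℝ} (hx : ∑ k, x k ^ 2 = 1) (hy : ∑ k, y k ^ 2 = 1)
    (h0 : 0 ≤ ∑ k, x k * y k) (h1 : ∑ k, x k * y k ≤ 1) :
    0.85 * ∑ k, x k * y k ≤ roundedCorr x y ∧
      roundedCorr x y ≤ roundedNormSq * ∑ k, x k * y k := by
  set t := ∑ k, x k * y k with ht
  have hsq : Real.sqrt t ^ 2 = t := Real.sq_sqrt h0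
  have hq := le_integral_norm_softSign_sq
  have hb := le_integral_inner_softSign_self
  have hint : Integrable (fun w => ‖w‖ ^ 2) (stdGaussian (EuclideanSpace ℝ (Fin 4))) := by
    by_contra h
    have := integral_norm_sq_stdGaussian
    rw [integral_undef h] at this
    norm_num at this
  rw [roundedCorr_eq (τ := Real.sqrt t) hx hy (by rw [hsq]; exact h1) (by rw [hsq])]
  constructor
  · have h := sq_integral_inner_id_mul_le continuous_softSign norm_softSign_le_one hint
      (τ := Real.sqrt t) (by rw [hsq]; exact h1)
    rw [hsq, integral_norm_sq_stdGaussian] at h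
    have h2 : 3.4 * t ≤
        (∫ x, inner ℝ (softSign x) x ∂(stdGaussian (EuclideanSpace ℝ (Fin 4)))) ^ 2 * t :=
      mul_le_mul_of_nonneg_right (by nlinarith) h0
    linarith
  · have h := integral_norm_mehler_sq_le continuous_softSign norm_softSign_le_one softSign_neg
      norm_softSign_sub_le hint (by linarith) (Real.sqrt_nonneg t) (Real.sqrt_le_one.2 h1)
    rwa [hsq] at h

/-- The defect `𝔼 ⟪δ(x), δ(y)⟫ - 0.9 ⟪x, y⟫` is largest, in absolute value, on the diagonal. -/
lemma abs_roundedCorr_sub_le {x y : ι → ℝ} (hx : ∑ k, x k ^ 2 = 1) (hy : ∑ k, y k ^ 2 = 1) :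
    |roundedCorr x y - 0.9 * ∑ k, x k * y k| ≤ roundedNormSq - 0.9 := by
  have hq : 0.98 ≤ roundedNormSq := le_integral_norm_softSign_sq
  have hcs : (∑ k, x k * y k) ^ 2 ≤ 1 := by
    have := Finset.sum_mul_sq_le_sq_mul_sq Finset.univ x y
    rwa [hx, hy, one_mul] at this
  have h1 : |∑ k, x k * y k| ≤ 1 := (sq_le_one_iff_abs_le_one _).1 hcs
  rw [abs_le] at h1
  -- the case of nonnegative correlation; the other one follows by replacing `y` by `-y`
  have key : ∀ z : ι → ℝ, ∑ k, z k ^ 2 = 1 → 0 ≤ ∑ k, x k * z k → ∑ k, x k * z k ≤ 1 →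
      |roundedCorr x z - 0.9 * ∑ k, x k * z k| ≤ roundedNormSq - 0.9 := by
    intro z hz h0 h1
    obtain ⟨hl, hu⟩ := roundedCorr_bounds hx hz h0 h1
    rw [abs_le]
    constructor <;> nlinarith
  rcases le_total 0 (∑ k, x k * y k) with h | h
  · exact key y hy h h1.2
  · have h2 := key (-y) (by simpa using hy) (by simpa using h) (by simp; linarith)
    rw [roundedCorr_neg] at h2
    simp only [Pi.neg_apply, mul_neg, Finset.sum_neg_distrib] at h2
    rwa [← neg_add', abs_neg, ← sub_eq_add_neg] at h2

/-- Gaussian rounding: unit vectors of any Euclidean space can be replaced by vectors of the unit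
ball of `ℝ⁴` at the cost of at most a factor `0.9`. -/
theorem IsSymmDiagDominant.exists_rounding {n : ℕ} {A : Matrix (Fin n) (Fin n) ℝ}
    (hA : IsSymmDiagDominant A) (x : Fin n → EuclideanSpace ℝ ι) (hx : ∀ i, ‖x i‖ = 1) :
    ∃ δ : Fin n → EuclideanSpace ℝ (Fin 4), (∀ i, ‖δ i‖ ≤ 1) ∧
      0.9 * realForm A x x ≤ realForm A δ δ := by
  have hx' : ∀ i, ∑ k, x i k ^ 2 = 1 := fun i => by
    rw [← EuclideanSpace.real_norm_sq_eq, hx, one_pow]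
  have hinner : ∀ i j, inner ℝ (x i) (x j) = ∑ k, x i k * x j k := fun i j => by
    rw [PiLp.inner_apply]
    exact Finset.sum_congr rfl fun k _ => by simp [mul_comm]
  have hnn := hA.sum_mul_nonneg
    (d := fun i j => roundedCorr (x i) (x j) - 0.9 * ∑ k, x i k * x j k)
    (c := roundedNormSq - 0.9)
    (fun i => by
      have h := hx' i
      simp only [sq] at h
      rw [roundedCorr_self (hx' i), h, mul_one])
    fun i j => abs_roundedCorr_sub_le (hx' i) (hx' j)
  have hterm : ∀ i j, Integrable (fun g => A i j *
      inner ℝ (softSign (linComb (x i) g)) (softSign (linComb (x j) g))) (columnLaw ι) :=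
    fun i j => (integrable_roundedCorr (x i) (x j)).const_mul _
  have hsum : ∀ i, Integrable (fun g => ∑ j, A i j *
      inner ℝ (softSign (linComb (x i) g)) (softSign (linComb (x j) g))) (columnLaw ι) :=
    fun i => integrable_finsetSum _ fun j _ => hterm i j
  have hint : Integrable (fun g => realForm A (fun i => softSign (linComb (x i) g))
      (fun i => softSign (linComb (x i) g))) (columnLaw ι) :=
    integrable_finsetSum _ fun i _ => hsum i
  have hmean : ∫ g, realForm A (fun i => softSign (linComb (x i) g))
      (fun i => softSign (linComb (x i) g)) ∂(columnLaw ι) =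
      ∑ i, ∑ j, A i j * roundedCorr (x i) (x j) := by
    simp only [realForm]
    rw [integral_finsetSum _ fun i _ => hsum i]
    refine Finset.sum_congr rfl fun i _ => ?_
    rw [integral_finsetSum _ fun j _ => hterm i j]
    exact Finset.sum_congr rfl fun j _ => integral_const_mul _ _
  obtain ⟨g, hg⟩ := exists_integral_le hint
  refine ⟨fun i => softSign (linComb (x i) g), fun i => norm_softSign_le_one _, le_trans ?_ hg⟩
  rw [hmean, realForm]
  simp only [mul_sub, Finset.sum_sub_distrib, sub_nonneg, ← hinner, mul_left_comm _ (0.9 : ℝ),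
    ← Finset.mul_sum] at hnn
  exact hnn

end Rounding

/-! ### Comparison of the maxima -/

section Comparison

variable {n l : ℕ} {A : Matrix (Fin n) (Fin n) ℝ}

lemma realForm_map {E F : Type*} [NormedAddCommGroup E] [InnerProductSpace ℝ E]
    [NormedAddCommGroup F] [InnerProductSpace ℝ F] (e : E ≃ₗᵢ[ℝ] F) (x y : Fin n → E) :
    realForm A (fun i => e (x i)) (fun i => e (y i)) = realForm A x y := by
  simp [realForm, LinearIsometryEquiv.inner_map_map]

lemma realForm_toVec (δ : Fin n → ℍ[ℝ]) :
    realForm A (fun i => toVec (δ i)) (fun i => toVec (δ i)) = realForm A δ δ := by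
  simp [realForm, toVec, PiLp.inner_apply]

/-- The maximum over families of vectors of `ℍ^l` is at most `10/9` times the maximum over
families of quaternions. -/
theorem IsSymmDiagDominant.le_of_isGreatest (hA : IsSymmDiagDominant A) {M N : ℝ}
    (hM : IsGreatest (vecSphereValues A l) M) (hN : IsGreatest (vecBallValues A 1) N) :
    0.9 * M ≤ N := by
  obtain ⟨x, hx, rfl⟩ := hM.1
  let e := (stdOrthonormalBasis ℝ (EuclideanSpace ℍ[ℝ] (Fin l))).repr
  obtain ⟨δ, hδ, h⟩ := hA.exists_rounding (fun i => e (x i)) fun i => by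
    rw [e.norm_map, hx]
  let q := Quaternion.linearIsometryEquivTuple.symm
  have hmem : vecForm A (fun i => toVec (q (δ i))) (fun i => toVec (q (δ i))) ∈
      vecBallValues A 1 :=
    ⟨_, fun i => by rw [norm_toVec, q.norm_map]; exact hδ i, rfl⟩
  have hle := hN.2 hmem
  rw [hA.vecForm_self, realForm_toVec, realForm_map q] at hle
  rw [realForm_map e] at h
  rw [hA.vecForm_self]
  exact h.trans hle

end Comparison

end QuatGrothendieck

end

theorem mainTheorem8 :
    (∀ (n : ℕ) (A : Matrix (Fin n) (Fin n) ℝ), QuatGrothendieck.IsSymmDiagDominant A →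
      ∃ N : ℝ,
        IsGreatest (QuatGrothendieck.scalSphereValues A) N ∧
        IsGreatest (QuatGrothendieck.scalBallValues A) N ∧
        IsGreatest (QuatGrothendieck.scalPairValues A) N ∧
        ∀ l : ℕ, 0 < l →
          ∃ M : ℝ,
            IsGreatest (QuatGrothendieck.vecSphereValues A l) M ∧
            IsGreatest (QuatGrothendieck.vecBallValues A l) M ∧
            IsGreatest (QuatGrothendieck.vecPairValues A l) M ∧
            M ≤ QuatGrothendieck.ddConstant * N) ∧
    |QuatGrothendieck.ddConstant - 1.1204| < 0.00005 := by
  refine ⟨fun n A hA => ?_, QuatGrothendieck.abs_ddConstant_sub_lt⟩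
  obtain ⟨N, hN1, hN2, hN3⟩ := hA.exists_isGreatest one_pos
  refine ⟨N, QuatGrothendieck.scalSphereValues_eq A ▸ hN1,
    QuatGrothendieck.scalBallValues_eq A ▸ hN2, QuatGrothendieck.scalPairValues_eq A ▸ hN3,
    fun l hl => ?_⟩
  obtain ⟨M, hM1, hM2, hM3⟩ := hA.exists_isGreatest hl
  refine ⟨M, hM1, hM2, hM3, ?_⟩
  have hle := hA.le_of_isGreatest hM1 hN2
  have hN0 : 0 ≤ N := by
    obtain ⟨y, -, rfl⟩ := hN1.1
    exact norm_nonneg _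
  have hc := (abs_lt.1 QuatGrothendieck.abs_ddConstant_sub_lt).1
  have h := mul_le_mul_of_nonneg_right (show 10 / 9 ≤ QuatGrothendieck.ddConstant by linarith) hN0
  linarith
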